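/- A \emph{square complex} is a two-dimensional cell complex whose 1-cells are intervals attached at their ends to vertices and whose 2-cells are squares, each attached along a closed edge path of length four. A \emph{hyperplane} is dual to an equivalence class of 1-cells under the relation generated by being opposite sides of a square: it is the union of the midpoints of the 1-cells of the class and of the midcubes of squares that join midpoints of opposite sides in the class. Condition $(\ast)$ says that every hyperplane is a simple arc (an embedded, non-closed path; a single point is allowed, for a 1-cell that lies in no square), and that any two distinct hyperplanes intersect in at most two points. A \emph{spur} is a vertex of degree one, and a \emph{corner} is a vertex of degree two that lies in exactly one square (as exactly one of its corners). \textbf{Corollary.} Let $X$ be a finite planar square complex (that is, one whose underlying space embeds in the Euclidean plane) that is homotopy equivalent to a disk and whose hyperplanes satisfy condition $(\ast)$. If $X$ contains at least two 1-cells, then $X$ has at least two corners and/or spurs, i.e. there are two distinct vertices of $X$, each of which is a corner or a spur. -/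

import Mathlib

open scoped unitInterval ContinuousMap

universe u

/-- A square complex: a set `V` of vertices, a set `E` of 1-cells, each of them an interval whose
two ends are attached to vertices, and a set `Q` of squares, each of them attached along a closed
edge path of length four. Loops, multiple edges and squares with identifications on their boundary
are allowed. -/
structure SquareComplex : Type (u + 1) where
  /-- the vertices -/
  V : Type u
  /-- the 1-cells -/
  E : Type u
  /-- the 2-cells -/
  Q : Type u
  /-- `ends e false` is the initial vertex and `ends e true` the terminal vertex of `e` -/
  ends : E → Bool → V
  /-- The `i`-th side of a square is a directed 1-cell `(e, b)`: the 1-cell `e`, traversed from its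
  initial to its terminal vertex if `b = true`, and backwards if `b = false`. -/
  side : Q → Fin 4 → E × Bool
  /-- The four sides form a closed path: each side ends where the next one starts. -/
  side_closed : ∀ q i,
    ends (side q i).1 (side q i).2 = ends (side q (i + 1)).1 (!(side q (i + 1)).2)

namespace SquareComplex

/-! ### The underlying topological space -/

/-- The disjoint union of one point for each vertex, one copy of `[0,1]` for each 1-cell and one
copy of `[0,1] × [0,1]` for each square. -/
abbrev Cells (X : SquareComplex.{u}) : Type _ :=
  (Σ _ : X.V, Unit) ⊕ (Σ _ : X.E, I) ⊕ (Σ _ : X.Q, I × I)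

/-- the vertex `v` as a point of the disjoint union of the cells -/
def vertexPt (X : SquareComplex.{u}) (v : X.V) : X.Cells := Sum.inl ⟨v, ()⟩

/-- the point with parameter `t` of the 1-cell `e` -/
def edgePt (X : SquareComplex.{u}) (e : X.E) (t : I) : X.Cells := Sum.inr (Sum.inl ⟨e, t⟩)

/-- the point with parameter `t` of the directed 1-cell `d` -/
def dirEdgePt (X : SquareComplex.{u}) (d : X.E × Bool) (t : I) : X.Cells :=
  X.edgePt d.1 (if d.2 then t else unitInterval.symm t)

/-- the point with coordinates `p` of the square `q` -/
def squarePt (X : SquareComplex.{u}) (q : X.Q) (p : I × I) : X.Cells := Sum.inr (Sum.inr ⟨q, p⟩)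

/-- The `i`-th side of the unit square, parametrized counterclockwise. -/
def sidePath : Fin 4 → I → I × I
  | 0, t => (t, 0)
  | 1, t => (1, t)
  | 2, t => (unitInterval.symm t, 1)
  | 3, t => (0, unitInterval.symm t)

/-- The gluing: the two ends of every 1-cell are attached to its end vertices, and the sides of
every square are attached to the corresponding directed 1-cells. -/
inductive Glue (X : SquareComplex.{u}) : X.Cells → X.Cells → Prop
  | start (e : X.E) : Glue X (X.edgePt e 0) (X.vertexPt (X.ends e false))
  | finish (e : X.E) : Glue X (X.edgePt e 1) (X.vertexPt (X.ends e true))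
  | side (q : X.Q) (i : Fin 4) (t : I) :
      Glue X (X.squarePt q (sidePath i t)) (X.dirEdgePt (X.side q i) t)

/-- The topological space underlying a square complex: the quotient of the disjoint union of the
cells by the equivalence relation that the gluing generates, with the quotient topology. -/
def Realization (X : SquareComplex.{u}) : Type _ := Quot X.Glue

instance (X : SquareComplex.{u}) : TopologicalSpace X.Realization :=
  inferInstanceAs (TopologicalSpace (Quot X.Glue))

/-- The complex has finitely many cells. -/
def IsFinite (X : SquareComplex.{u}) : Prop := Finite X.V ∧ Finite X.E ∧ Finite X.Q

/-- The complex embeds topologically in the Euclidean plane. -/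
def IsPlanar (X : SquareComplex.{u}) : Prop :=
  ∃ f : X.Realization → EuclideanSpace ℝ (Fin 2), Topology.IsEmbedding f

/-- The complex is homotopy equivalent to the closed unit disk. -/
def HomotopyEquivDisk (X : SquareComplex.{u}) : Prop :=
  Nonempty (X.Realization ≃ₕ Metric.closedBall (0 : EuclideanSpace ℝ (Fin 2)) 1)

/-! ### Hyperplanes -/

/-- Two 1-cells are opposite in some square. -/
def Opposite (X : SquareComplex.{u}) (e e' : X.E) : Prop :=
  ∃ q k, (X.side q k).1 = e ∧ (X.side q (k + 2)).1 = e'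

/-- A hyperplane, given by the class of its dual 1-cells under the equivalence relation generated
by being opposite in a square. The hyperplane consists of the midpoints of its dual 1-cells and of
the midcubes of the squares that join the midpoints of opposite sides dual to the hyperplane. -/
def Hyperplane (X : SquareComplex.{u}) : Type _ := Quot X.Opposite

/-- the hyperplane dual to a 1-cell -/
def hyp (X : SquareComplex.{u}) (e : X.E) : X.Hyperplane := Quot.mk _ e

/-- the hyperplane that contains the midcube of `q` which joins the sides `k` and `k + 2` -/
def midcubeHyp (X : SquareComplex.{u}) (q : X.Q) (k : Fin 4) : X.Hyperplane := X.hyp (X.side q k).1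

/-- The hyperplane `h` is a simple arc: it is an embedded path (possibly a single point), which
crosses pairwise distinct dual 1-cells `e 0, …, e n` and, between them, pairwise distinct squares
`q 0, …, q (n-1)`, and has no further dual 1-cells and no further midcubes. In particular it is
not closed, does not branch, and never crosses itself inside a square. -/
def IsSimpleArc (X : SquareComplex.{u}) (h : X.Hyperplane) : Prop :=
  ∃ (n : ℕ) (e : Fin (n + 1) → X.E) (q : Fin n → X.Q),
    Function.Injective e ∧ Function.Injective q ∧
    (∀ a, X.hyp a = h ↔ a ∈ Set.range e) ∧
    (∀ s, (∃ k, X.midcubeHyp s k = h) ↔ s ∈ Set.range q) ∧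
    ∀ i : Fin n, ∃ k : Fin 4,
      (X.side (q i) k).1 = e i.castSucc ∧ (X.side (q i) (k + 2)).1 = e i.succ ∧
      X.midcubeHyp (q i) (k + 1) ≠ h

/-- The squares at whose centers the hyperplanes `h` and `h'` cross. Distinct hyperplanes meet in
these centers and nowhere else. -/
def crossings (X : SquareComplex.{u}) (h h' : X.Hyperplane) : Set X.Q :=
  {s | ∃ k, X.midcubeHyp s k = h ∧ X.midcubeHyp s (k + 1) = h'}

/-- Condition (∗): the hyperplanes are simple arcs, and any two of them intersect in at most two
points. -/
def ConditionStar (X : SquareComplex.{u}) : Prop :=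
  (∀ h, X.IsSimpleArc h) ∧ ∀ h h', h ≠ h' → (X.crossings h h').encard ≤ 2

/-! ### Corners and spurs -/

/-- The degree of a vertex: the number of ends of 1-cells at `v` (a loop counts twice). -/
noncomputable def degree (X : SquareComplex.{u}) (v : X.V) : ℕ :=
  {d : X.E × Bool | X.ends d.1 d.2 = v}.ncard

/-- The number of corners of squares at `v`; the `i`-th corner of a square is the starting point of
its `i`-th side. -/
noncomputable def squareDegree (X : SquareComplex.{u}) (v : X.V) : ℕ :=
  {c : X.Q × Fin 4 | X.ends (X.side c.1 c.2).1 (!(X.side c.1 c.2).2) = v}.ncard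

/-- A spur is a vertex of degree one. -/
def IsSpur (X : SquareComplex.{u}) (v : X.V) : Prop := X.degree v = 1

/-- A corner is a vertex of degree two that lies in exactly one square (as exactly one of its
corners). -/
def IsCorner (X : SquareComplex.{u}) (v : X.V) : Prop := X.degree v = 2 ∧ X.squareDegree v = 1

end SquareComplex

namespace SquareComplex

variable {X : SquareComplex.{u}}

/-! ### Maps out of the realization -/

/-! Contractibility enters as a substitute for the Jordan curve theorem: integral cellular cocycles
are coboundaries (`exists_potential`), so a transverse curve in the complex defines a two-colouring
of the vertices that changes exactly where the curve crosses a 1-cell (`exists_coloring`). That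
hyperplanes are simple arcs means that at most two squares meet along a 1-cell
(`IsHypIndex.eq_flip`), so each maximal family of squares connected through 1-cells (a block) has
boundary walks along its free sides.

At a free side of a boundary walk, a curve may enter the square and turn left or right along the
hyperplane parallel to that side, until it reaches the boundary again. At time `t` the left ray is
that of `(d.walk t).turn`, the right ray that of `(d.walk t).rev.turn`. The colourings show that
both curves return to the same boundary walk, the right one first.

Suppose a round of the walk meets no corner of the block. From a side whose left ray lands only in
the next round, one finds an earlier side whose left ray lands still later: otherwise two
hyperplanes would cross three times (`lands_right_of_lands_left`, `lt_lands_left`). This descent is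
impossible, which proves `exists_corner_gap`. The corner obtained avoids the starting point of the
walk, so starting again from it yields a second one.

A corner of a block is a corner of the complex unless its vertex has a disconnected link. A
component of the link of a vertex determines a branch, and induction on the number of vertices finds
a corner or spur in every branch (`exists_corner_or_spur_in_branch`). A vertex with disconnected
link has two disjoint branches; if all links are connected, the complex is a single 1-cell or the
two corners of a block suffice. -/

theorem exists_realization_map {Y : Type*} [TopologicalSpace Y] (fV : X.V → Y) (fE : X.E → I → Y)
    (fQ : X.Q → I × I → Y) (hE : ∀ e, Continuous (fE e)) (hQ : ∀ q, Continuous (fQ q))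
    (hstart : ∀ e, fE e 0 = fV (X.ends e false)) (hfinish : ∀ e, fE e 1 = fV (X.ends e true))
    (hside : ∀ q i t, fQ q (sidePath i t) =
      fE (X.side q i).1 (if (X.side q i).2 then t else unitInterval.symm t)) :
    ∃ (F : C(X.Realization, Y)) (p : X.V → X.Realization) (c : X.E → C(I, X.Realization)),
      (∀ v, F (p v) = fV v) ∧ (∀ e t, F (c e t) = fE e t) ∧
      (∀ e, c e 0 = p (X.ends e false)) ∧ ∀ e, c e 1 = p (X.ends e true) := by
  let g : X.Cells → Y := Sum.elim (fun v => fV v.1)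
    (Sum.elim (fun e => fE e.1 e.2) (fun q => fQ q.1 q.2))
  have hg : Continuous g := by
    refine Continuous.sumElim ?_ (Continuous.sumElim ?_ ?_)
    · exact continuous_sigma fun v => (continuous_const : Continuous fun _ : Unit => fV v)
    · exact continuous_sigma fun e => hE e
    · exact continuous_sigma fun q => hQ q
  have hglue : ∀ a b, X.Glue a b → g a = g b := by
    rintro _ _ (e | e | ⟨q, i, t⟩)
    · exact hstart e
    · exact hfinish e
    · exact hside q i t
  have hmk : Continuous (Quot.mk X.Glue : X.Cells → X.Realization) := continuous_quot_mk
  refine ⟨⟨Quot.lift g hglue, continuous_quot_lift hglue hg⟩, fun v => Quot.mk _ (X.vertexPt v),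
    fun e => ⟨fun t => Quot.mk _ (X.edgePt e t), hmk.comp ?_⟩, fun v => rfl, fun e t => rfl,
    fun e => Quot.sound (Glue.start e), fun e => Quot.sound (Glue.finish e)⟩
  exact continuous_inr.comp (continuous_inl.comp continuous_sigmaMk)

theorem HomotopyEquivDisk.contractibleSpace (h : X.HomotopyEquivDisk) :
    ContractibleSpace X.Realization := by
  obtain ⟨e⟩ := h
  have := Metric.contractibleSpace_closedBall (x := (0 : EuclideanSpace ℝ (Fin 2))) zero_le_one
  exact e.contractibleSpace

/-- In a connected square complex, a function on the vertices that takes equal values at the two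
ends of each 1-cell is constant. -/
theorem eq_of_forall_ends_eq [PreconnectedSpace X.Realization] (f : X.V → Bool)
    (hf : ∀ e, f (X.ends e false) = f (X.ends e true)) (v w : X.V) : f v = f w := by
  obtain ⟨F, p, -, hp, -⟩ := exists_realization_map f (fun e _ => f (X.ends e false))
    (fun q _ => f (X.ends (X.side q 0).1 false)) (fun _ => continuous_const)
    (fun _ => continuous_const) (fun _ => rfl) (fun e => hf e) (by
      have key : ∀ q i, f (X.ends (X.side q i).1 false) =
          f (X.ends (X.side q (i + 1)).1 false) := by
        intro q i
        have h0 : ∀ e b, f (X.ends e b) = f (X.ends e false) := by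
          intro e b; cases b
          · rfl
          · exact (hf e).symm
        have := congrArg f (X.side_closed q i)
        exact (h0 _ _).symm.trans (this.trans (h0 _ _))
      intro q i t
      have h1 := key q 0
      have h2 := key q 1
      have h3 := key q 2
      fin_cases i
      · rfl
      · exact h1
      · exact h1.trans h2
      · exact h1.trans (h2.trans h3))
  rw [← hp, ← hp]
  exact PreconnectedSpace.constant ‹_› F.continuous

/-- A map from a contractible space is homotopic to a constant, which lifts; the covering homotopy
property of the line over the circle carries the lift along the reversed homotopy. -/
theorem exists_real_lift {A : Type*} [TopologicalSpace A] [ContractibleSpace A]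
    (F : C(A, AddCircle (1 : ℝ))) : ∃ G : C(A, ℝ), ∀ a, (G a : AddCircle (1 : ℝ)) = F a := by
  obtain ⟨a₀, ⟨H⟩⟩ := (id_nullhomotopic A).comp_right F
  obtain ⟨r, hr⟩ := QuotientAddGroup.mk_surjective a₀
  have cov := AddCircle.isCoveringMap_coe (𝕜 := ℝ) 1
  have h0 : ∀ a, H.symm (0, a) = ((ContinuousMap.const A r a : ℝ) : AddCircle (1 : ℝ)) := by
    intro a
    rw [ContinuousMap.Homotopy.apply_zero]
    exact hr.symm
  refine ⟨(cov.liftHomotopy H.symm.toContinuousMap _ h0).comp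
    ((ContinuousMap.const A 1).prodMk (ContinuousMap.id A)), fun a => ?_⟩
  have := congrFun (cov.liftHomotopy_lifts H.symm.toContinuousMap _ h0) (1, a)
  refine this.trans ?_
  exact (ContinuousMap.Homotopy.apply_one _ _).trans rfl

/-- An integral cellular 1-cocycle of a contractible square complex is a coboundary. -/
theorem exists_potential [ContractibleSpace X.Realization] (φ : X.E → ℤ)
    (hφ : ∀ q, ∑ i, (if (X.side q i).2 then φ (X.side q i).1 else -φ (X.side q i).1) = 0) :
    ∃ χ : X.V → ℤ, ∀ e, χ (X.ends e true) = χ (X.ends e false) + φ e := by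
  let w : X.Q → Fin 4 → ℝ := fun q i =>
    ((if (X.side q i).2 then φ (X.side q i).1 else -φ (X.side q i).1 : ℤ) : ℝ)
  have hw : ∀ q, w q 0 + w q 1 + w q 2 + w q 3 = 0 := by
    intro q
    have := hφ q
    rw [Fin.sum_univ_four] at this
    simp only [w]
    exact_mod_cast this
  have hint : ∀ n : ℤ, ((n : ℝ) : AddCircle (1 : ℝ)) = 0 := by
    intro n
    rw [AddCircle.coe_eq_zero_iff]
    exact ⟨n, by simp⟩
  obtain ⟨F, p, c, hp, hc, hc0, hc1⟩ := exists_realization_map (Y := AddCircle (1 : ℝ))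
    (fun _ => 0) (fun e t => (((t : ℝ) * φ e : ℝ) : AddCircle (1 : ℝ)))
    -- Bilinear interpolation of the partial sums `0`, `w 0`, `w 0 + w 1`, `w 0 + w 1 + w 2` at the
    -- four successive corners. On each side it agrees with the map of the 1-cell up to an integer;
    -- on the last side this uses the cocycle condition.
    (fun q x => ((w q 0 * x.1 * (1 - x.2) + (w q 0 + w q 1) * x.1 * x.2 +
      (w q 0 + w q 1 + w q 2) * (1 - x.1) * x.2 : ℝ) : AddCircle (1 : ℝ)))
    (fun e => (AddCircle.continuous_mk' 1).comp (by fun_prop))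
    (fun q => (AddCircle.continuous_mk' 1).comp (by fun_prop))
    (fun e => by simp) (fun e => by simp [hint])
    (by
      intro q i t
      have h3 := hw q
      rw [← sub_eq_zero, ← AddCircle.coe_sub]
      have hpos : ∀ n : ℤ, ∀ x y : ℝ, x - y = n → ((x - y : ℝ) : AddCircle (1 : ℝ)) = 0 := by
        intro n x y hxy
        rw [hxy]; exact hint n
      have hwi : w q i = if (X.side q i).2 then (φ (X.side q i).1 : ℝ)
          else -(φ (X.side q i).1 : ℝ) := by
        simp only [w]; split_ifs <;> simp
      have hz : ∀ j, ∃ n : ℤ, w q j = n := fun j => ⟨_, rfl⟩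
      obtain ⟨n0, h0⟩ := hz 0
      obtain ⟨n1, h1⟩ := hz 1
      obtain ⟨n2, h2⟩ := hz 2
      have main : ∀ s : ℝ, ∀ n : ℤ, s = n + t * w q i →
          ((s - ((if (X.side q i).2 then t else unitInterval.symm t : I) : ℝ) *
            (φ (X.side q i).1 : ℝ) : ℝ) : AddCircle (1 : ℝ)) = 0 := by
        intro s n hs
        rw [hs, hwi]
        split_ifs
        · apply hpos n; ring
        · apply hpos (n - φ (X.side q i).1)
          rw [unitInterval.coe_symm_eq]; push_cast; ring
      fin_cases i
      · apply main _ 0; simp [sidePath]; ring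
      · apply main _ n0; simp [sidePath]; rw [← h0]; ring
      · apply main _ (n0 + n1); simp [sidePath]; rw [← h0, ← h1]; ring
      · apply main _ (n0 + n1 + n2)
        have : w q 3 = -(w q 0 + w q 1 + w q 2) := by linarith
        simp [sidePath, this]; rw [← h0, ← h1, ← h2]; ring)
  obtain ⟨G, hG⟩ := exists_real_lift F
  have hGv : ∀ v, ∃ n : ℤ, (n : ℝ) = G (p v) := by
    intro v
    have : (G (p v) : AddCircle (1 : ℝ)) = 0 := by rw [hG, hp]
    rw [AddCircle.coe_eq_zero_iff] at this
    obtain ⟨n, hn⟩ := this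
    exact ⟨n, by simpa using hn⟩
  choose χ hχ using hGv
  refine ⟨χ, fun e => ?_⟩
  have cov := AddCircle.isCoveringMap_coe (𝕜 := ℝ) 1
  -- Both sides lift the same path in the circle and agree at `0`, so uniqueness of lifts applies.
  have h1 : (fun t => G (c e t)) = fun t : I => G (c e 0) + t * φ e := by
    refine cov.eq_of_comp_eq (by fun_prop) (by fun_prop) ?_ 0 (by simp)
    funext t
    simp only [Function.comp_apply, AddCircle.coe_add, hG, hc]
    simp
  have h2 := congrFun h1 1
  simp only [hc0, hc1, ← hχ] at h2
  have h3 : (χ (X.ends e true) : ℝ) = χ (X.ends e false) + φ e := by simpa using h2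
  exact_mod_cast h3

/-! ### Flags -/

/-- A flag of a square complex: a square, one of its sides, and a direction of that side
(`fwd = true` is the direction of the boundary path). It represents the side together with the end
at which the directed side starts. -/
@[ext]
structure Flag (X : SquareComplex.{u}) : Type u where
  /-- the square -/
  sq : X.Q
  /-- the position of the side -/
  pos : Fin 4
  /-- the direction of the side -/
  fwd : Bool

namespace Flag

/-- the end of a 1-cell at which the directed side starts -/
def half (d : Flag X) : X.E × Bool :=
  ((X.side d.sq d.pos).1, xor d.fwd (X.side d.sq d.pos).2)

/-- the 1-cell underlying the side -/
def edge (d : Flag X) : X.E := (X.side d.sq d.pos).1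

/-- the vertex at which the directed side starts -/
def src (d : Flag X) : X.V := X.ends d.half.1 d.half.2

/-- the same side in the opposite direction -/
def rev (d : Flag X) : Flag X := ⟨d.sq, d.pos, !d.fwd⟩

/-- the other side of the square that starts at the same corner -/
def turn (d : Flag X) : Flag X := ⟨d.sq, bif d.fwd then d.pos - 1 else d.pos + 1, !d.fwd⟩

/-- the opposite side of the square, in the parallel direction -/
def opp (d : Flag X) : Flag X := ⟨d.sq, d.pos + 2, !d.fwd⟩

@[simp] theorem rev_rev (d : Flag X) : d.rev.rev = d := by simp [rev]

@[simp] theorem turn_turn (d : Flag X) : d.turn.turn = d := by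
  obtain ⟨q, k, b⟩ := d
  cases b <;> simp [turn]

@[simp] theorem opp_opp (d : Flag X) : d.opp.opp = d := by
  obtain ⟨q, k, b⟩ := d
  simp only [opp, Bool.not_not, mk.injEq, and_true, true_and]
  revert k; decide

theorem turn_rev_turn (d : Flag X) : d.turn.rev.turn = d.opp := by
  obtain ⟨q, k, b⟩ := d
  cases b <;> simp only [opp, turn, rev, mk.injEq, and_true, true_and, Bool.not_true,
    Bool.not_false, cond_true, cond_false] <;> revert k <;> decide

theorem opp_turn (d : Flag X) : d.opp.turn = d.turn.rev := by
  rw [← turn_rev_turn, turn_turn]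

theorem turn_rev (d : Flag X) : d.rev.turn = d.turn.opp := by
  rw [← turn_rev_turn, turn_turn]

@[simp] theorem rev_sq (d : Flag X) : d.rev.sq = d.sq := rfl
@[simp] theorem turn_sq (d : Flag X) : d.turn.sq = d.sq := rfl
@[simp] theorem opp_sq (d : Flag X) : d.opp.sq = d.sq := rfl
@[simp] theorem half_fst (d : Flag X) : d.half.1 = d.edge := rfl
@[simp] theorem rev_edge (d : Flag X) : d.rev.edge = d.edge := rfl
theorem opp_rev (d : Flag X) : d.rev.opp = d.opp.rev := rfl

theorem rev_ne (d : Flag X) : d.rev ≠ d := by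
  intro h
  have := congrArg fwd h
  simp [rev] at this

theorem turn_ne (d : Flag X) : d.turn ≠ d := by
  intro h
  have := congrArg fwd h
  simp [turn] at this

theorem half_rev (d : Flag X) : d.rev.half = (d.half.1, !d.half.2) := by
  simp [half, rev]

theorem edge_eq_of_half_eq {d d' : Flag X} (h : d.half = d'.half) : d.edge = d'.edge := by
  rw [← half_fst, ← half_fst, h]

theorem half_eq_or_of_edge_eq {d d' : Flag X} (h : d.edge = d'.edge) :
    d.half = d'.half ∨ d.rev.half = d'.half := by
  rw [half_rev, Prod.ext_iff, Prod.ext_iff]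
  simp only [half_fst, h, true_and]
  cases d.half.2 <;> cases d'.half.2 <;> simp

@[simp] theorem turn_src (d : Flag X) : d.turn.src = d.src := by
  have key : ∀ q (k : Fin 4), (⟨q, k, false⟩ : Flag X).src = (⟨q, k + 1, true⟩ : Flag X).src := by
    intro q k
    have := X.side_closed q k
    simpa [src, half] using this
  obtain ⟨q, k, b⟩ := d
  cases b
  · exact (key q k).symm
  · have := key q (k - 1)
    rw [sub_add_cancel] at this
    exact this

theorem src_eq_of_half_eq {d d' : Flag X} (h : d.half = d'.half) : d.src = d'.src := by
  rw [src, src, h]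

theorem opp_hyp (d : Flag X) : X.hyp d.opp.edge = X.hyp d.edge :=
  (Quot.sound ⟨d.sq, d.pos, rfl, rfl⟩ : X.hyp d.edge = X.hyp d.opp.edge).symm

theorem rev_turn_hyp (d : Flag X) : X.hyp d.rev.turn.edge = X.hyp d.turn.edge := by
  rw [turn_rev, opp_hyp]

/-- The hyperplanes through the square of a flag cross there. -/
theorem sq_mem_crossings (d : Flag X) : d.sq ∈ X.crossings (X.hyp d.edge) (X.hyp d.turn.edge) := by
  obtain ⟨q, k, b⟩ := d
  cases b
  · exact ⟨k, rfl, rfl⟩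
  · refine ⟨k, rfl, ?_⟩
    rw [← rev_turn_hyp]
    rfl

theorem eq_or_of_sq_eq {d d' : Flag X} (h : d.sq = d'.sq) : d' = d ∨ d' = d.rev ∨ d' = d.opp ∨
    d' = d.opp.rev ∨ d' = d.turn ∨ d' = d.turn.rev ∨ d' = d.turn.opp ∨ d' = d.turn.opp.rev := by
  obtain ⟨q, k, b⟩ := d
  obtain ⟨q', k', b'⟩ := d'
  obtain rfl : q = q' := h
  simp only [opp, turn, rev, mk.injEq, true_and]
  revert k k' b b'; decide

instance [Finite X.Q] : Finite (Flag X) :=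
  Finite.of_injective (fun d : Flag X => (d.sq, d.pos, d.fwd)) (by
    intro d d' h
    simp only [Prod.mk.injEq] at h
    exact Flag.ext h.1 h.2.1 h.2.2)

end Flag

/-! ### Positions along hyperplanes -/

/-- `idx` numbers the dual 1-cells of each hyperplane consecutively along the hyperplane. -/
structure IsHypIndex (X : SquareComplex.{u}) (idx : X.E → ℕ) : Prop where
  inj : ∀ {a b}, X.hyp a = X.hyp b → idx a = idx b → a = b
  opp : ∀ d : Flag X, idx d.opp.edge = idx d.edge + 1 ∨ idx d.edge = idx d.opp.edge + 1
  turn : ∀ d : Flag X, X.hyp d.turn.edge ≠ X.hyp d.edge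
  sq : ∀ {d d' : Flag X}, d.edge = d'.edge → d.opp.edge = d'.opp.edge → d.sq = d'.sq
  pred : ∀ a i, i ≤ idx a → ∃ b, X.hyp b = X.hyp a ∧ idx b = i
  succ : ∀ {a b}, X.hyp a = X.hyp b → idx b = idx a + 1 → ∃ d : Flag X, d.edge = a ∧ d.opp.edge = b

/-- The index of a 1-cell is its place in the arc chosen for its hyperplane. All later use of the
arc condition goes through this numbering. -/
theorem exists_hypIndex (hX : ∀ h, X.IsSimpleArc h) : ∃ idx, X.IsHypIndex idx := by
  choose n e q he hq hE hQ hs using hX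
  have h1 : ∀ a, ∃ i, e (X.hyp a) i = a := fun a => (hE _ a).1 rfl
  choose j hj using h1
  have hidx : ∀ h a i, e h i = a → X.hyp a = h ∧ (j a : ℕ) = i := by
    intro h a i hi
    have hh : X.hyp a = h := (hE h a).2 ⟨i, hi⟩
    subst hh
    refine ⟨rfl, ?_⟩
    have : j a = i := he _ ((hj a).trans hi.symm)
    rw [this]
  -- the two sides of the square of `d` that are dual to the hyperplane of `d`
  have hd : ∀ d : Flag X, ∃ i : Fin (n (X.hyp d.edge)), q _ i = d.sq ∧
      ((d.edge = e _ i.castSucc ∧ d.opp.edge = e _ i.succ) ∨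
        (d.opp.edge = e _ i.castSucc ∧ d.edge = e _ i.succ)) ∧
      X.hyp d.turn.edge ≠ X.hyp d.edge := by
    intro d
    obtain ⟨i, hi⟩ := (hQ (X.hyp d.edge) d.sq).1 ⟨d.pos, rfl⟩
    obtain ⟨f, hf, hf1, hf2, hf3⟩ : ∃ f : Flag X, f.sq = d.sq ∧ f.edge = e _ i.castSucc ∧
        f.opp.edge = e _ i.succ ∧ X.hyp f.turn.edge ≠ X.hyp d.edge := by
      obtain ⟨k, hk1, hk2, hk3⟩ := hs _ i
      rw [hi] at hk1 hk2 hk3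
      exact ⟨⟨d.sq, k, false⟩, rfl, hk1, hk2, hk3⟩
    refine ⟨i, hi, ?_⟩
    rcases Flag.eq_or_of_sq_eq hf.symm with h | h | h | h | h | h | h | h <;>
      rw [h] at hf1 hf2 hf3
    · exact ⟨.inl ⟨hf1, hf2⟩, hf3⟩
    · rw [Flag.rev_turn_hyp] at hf3
      exact ⟨.inl ⟨hf1, hf2⟩, hf3⟩
    · rw [Flag.opp_opp] at hf2
      rw [Flag.opp_turn] at hf3
      exact ⟨.inr ⟨hf1, hf2⟩, hf3⟩
    · rw [Flag.opp_rev, Flag.opp_opp] at hf2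
      rw [Flag.rev_turn_hyp, Flag.opp_turn] at hf3
      exact ⟨.inr ⟨hf1, hf2⟩, hf3⟩
    · rw [Flag.turn_turn] at hf3
      exact absurd rfl hf3
    · rw [Flag.rev_turn_hyp, Flag.turn_turn] at hf3
      exact absurd rfl hf3
    · rw [Flag.opp_turn, Flag.turn_turn] at hf3
      exact absurd rfl hf3
    · rw [Flag.rev_turn_hyp, Flag.opp_turn, Flag.turn_turn] at hf3
      exact absurd rfl hf3
  refine ⟨fun a => j a, ?_, ?_, ?_, ?_, ?_, ?_⟩
  · intro a b hab h
    obtain ⟨i, hi⟩ := (hE (X.hyp a) a).1 rfl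
    obtain ⟨i', hi'⟩ := (hE _ b).1 hab.symm
    rw [(hidx _ _ i hi).2, (hidx _ _ i' hi').2] at h
    exact hi.symm.trans ((congrArg _ (Fin.ext h)).trans hi')
  · intro d
    obtain ⟨i, -, h | h, -⟩ := hd d
    · left
      rw [(hidx _ _ _ h.1.symm).2, (hidx _ _ _ h.2.symm).2]; rfl
    · right
      rw [(hidx _ _ _ h.1.symm).2, (hidx _ _ _ h.2.symm).2]; rfl
  · intro d
    obtain ⟨i, -, -, h⟩ := hd d
    exact h
  · intro d d' h1 h2
    obtain ⟨i, hi, h, -⟩ := hd d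
    have hd' := hd d'
    rw [← h1, ← h2] at hd'
    obtain ⟨i', hi', h', -⟩ := hd'
    have key : i = i' := by
      rcases h with ⟨ha, hb⟩ | ⟨ha, hb⟩ <;> rcases h' with ⟨ha', hb'⟩ | ⟨ha', hb'⟩ <;>
      · have e1 := congrArg Fin.val (he _ (ha.symm.trans (by first | exact ha' | exact hb')))
        have e2 := congrArg Fin.val (he _ (hb.symm.trans (by first | exact hb' | exact ha')))
        simp only [Fin.val_castSucc, Fin.val_succ] at e1 e2
        ext; omega
    rw [← hi, ← hi', key]
  · intro a i hi
    have hlt : i < n (X.hyp a) + 1 := lt_of_le_of_lt hi (j a).2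
    exact ⟨e (X.hyp a) ⟨i, hlt⟩, hidx _ _ _ rfl⟩
  · intro a b hab h
    obtain ⟨i, hi⟩ := (hE (X.hyp a) a).1 rfl
    obtain ⟨i', hi'⟩ := (hE _ b).1 hab.symm
    rw [(hidx _ _ i hi).2, (hidx _ _ i' hi').2] at h
    have hlt : (i : ℕ) < n (X.hyp a) := by have := i'.2; omega
    obtain ⟨k, hk1, hk2, -⟩ := hs (X.hyp a) ⟨i, hlt⟩
    exact ⟨⟨_, k, false⟩, hk1.trans hi,
      hk2.trans ((congrArg _ (Fin.ext (by simp [h]))).trans hi')⟩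

/-! ### Colourings of the vertices -/

/-- `S` plays the role of one bank of a curve, and `g` pairs the ends at which the curve enters and
leaves a square. Counting the ends in `S` with sign is a cocycle because `g` reverses direction, so
contributions of a square cancel in pairs; the colouring is the parity of a potential. -/
theorem exists_coloring [ContractibleSpace X.Realization] (S : Set (X.E × Bool))
    (g : Flag X → Flag X) (hsq : ∀ d, (g d).sq = d.sq) (hfwd : ∀ d, (g d).fwd = !d.fwd)
    (hgg : ∀ d, g (g d) = d) (hS : ∀ d, d.half ∈ S → (g d).half ∈ S) :
    ∃ χ : X.V → Bool, ∀ e b, χ (X.ends e b) ≠ χ (X.ends e (!b)) ↔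
      Xor ((e, b) ∈ S) ((e, !b) ∈ S) := by
  classical
  have hS' : ∀ d, (g d).half ∈ S ↔ d.half ∈ S := fun d =>
    ⟨fun h => by simpa only [hgg] using hS _ h, hS d⟩
  let ι : X.E × Bool → ℤ := fun x => if x ∈ S then 1 else 0
  let φ : X.E → ℤ := fun e => ι (e, false) - ι (e, true)
  obtain ⟨χ, hχ⟩ := exists_potential φ (by
    intro q
    -- The boundary sum is split into one signed term for each of the eight flags of the square, on
    -- which `g` acts as a sign-reversing involution.
    let f : Fin 4 × Bool → ℤ := fun c => (if c.2 then 1 else -1) * ι (Flag.half ⟨q, c.1, c.2⟩)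
    have h1 : ∑ c, f c = 0 := by
      have hg : ∀ c : Fin 4 × Bool, (⟨q, (g ⟨q, c.1, c.2⟩).pos, (g ⟨q, c.1, c.2⟩).fwd⟩ : Flag X) =
          g ⟨q, c.1, c.2⟩ := fun c => Flag.ext (hsq ⟨q, c.1, c.2⟩).symm rfl rfl
      refine Finset.sum_involution
        (fun c _ => ((g ⟨q, c.1, c.2⟩).pos, (g ⟨q, c.1, c.2⟩).fwd)) ?_ ?_ ?_ ?_
      · intro c _
        simp only [f, hg, ι, hS']
        simp only [hfwd]
        cases c.2 <;> simp <;> split_ifs <;> rfl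
      · intro c _ _ h
        have := congrArg Prod.snd h
        simp [hfwd] at this
      · intro c _
        exact Finset.mem_univ _
      · intro c _
        simp only [hg, hgg]
    rw [Fintype.sum_prod_type] at h1
    rw [← h1]
    refine Finset.sum_congr rfl fun i _ => ?_
    simp only [Fintype.sum_bool, f, φ, Flag.half]
    cases (X.side q i).2 <;> simp <;> ring)
  refine ⟨fun v => decide (Odd (χ v)), fun e b => ?_⟩
  have key : ∀ e, decide (Odd (χ (X.ends e false))) ≠ decide (Odd (χ (X.ends e true))) ↔
      Xor ((e, false) ∈ S) ((e, true) ∈ S) := by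
    intro e
    rw [hχ e, Xor]
    by_cases h1 : (e, false) ∈ S <;> by_cases h2 : (e, true) ∈ S <;>
      simp [φ, ι, h1, h2, ← Int.not_even_iff_odd, parity_simps]
  cases b
  · exact key e
  · rw [ne_comm, _root_.xor_comm]
    exact key e

namespace Flag

/-! ### Crossing from a square to the next one -/

open Classical in
/-- the flag of the other square at the same side, if there is one, and the flag itself if not -/
noncomputable def flip (d : Flag X) : Flag X :=
  if h : ∃ d' : Flag X, d' ≠ d ∧ d'.half = d.half then h.choose else d

/-- The side of the flag lies in no other square. -/
def IsFree (d : Flag X) : Prop := d.flip = d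

theorem flip_half (d : Flag X) : d.flip.half = d.half := by
  unfold flip
  split_ifs with h
  · exact h.choose_spec.2
  · rfl

@[simp] theorem flip_edge (d : Flag X) : d.flip.edge = d.edge :=
  edge_eq_of_half_eq d.flip_half

@[simp] theorem flip_src (d : Flag X) : d.flip.src = d.src :=
  src_eq_of_half_eq d.flip_half

theorem IsFree.eq {d d' : Flag X} (h : d.IsFree) (h' : d'.half = d.half) : d' = d := by
  by_contra hne
  have hex : ∃ d' : Flag X, d' ≠ d ∧ d'.half = d.half := ⟨d', hne, h'⟩
  unfold IsFree flip at h
  rw [dif_pos hex] at h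
  exact hex.choose_spec.1 h

theorem IsFree.rev {d : Flag X} (h : d.IsFree) : d.rev.IsFree := by
  have h1 : d.rev.flip.rev = d := h.eq (by simp only [half_rev, flip_half, Bool.not_not])
  have h2 := congrArg Flag.rev h1
  rwa [rev_rev] at h2

theorem IsFree.eq_or_of_edge_eq {d d' : Flag X} (h : d.IsFree) (h' : d'.edge = d.edge) :
    d' = d ∨ d' = d.rev := by
  rcases half_eq_or_of_edge_eq h'.symm with h1 | h1
  · exact .inl (h.eq h1.symm)
  · exact .inr (h.rev.eq h1.symm)

end Flag

variable {idx : X.E → ℕ}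

namespace IsHypIndex

variable (hi : X.IsHypIndex idx)
include hi

theorem eq_of_sq_eq {d d' : Flag X} (h : d.sq = d'.sq) (h' : d.half = d'.half) : d = d' := by
  have he := Flag.edge_eq_of_half_eq h'
  have hopp : d.edge ≠ d.opp.edge := by
    intro h2
    have := hi.opp d
    rw [← h2] at this
    omega
  have hturn : ∀ a, X.hyp a = X.hyp d.turn.edge → d.edge ≠ a := by
    intro a ha hd
    rw [← hd] at ha
    exact hi.turn d ha.symm
  rcases Flag.eq_or_of_sq_eq h with rfl | rfl | rfl | rfl | rfl | rfl | rfl | rfl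
  · rfl
  · rw [Flag.half_rev, Prod.ext_iff] at h'
    simp at h'
  · exact absurd he hopp
  · exact absurd he hopp
  · exact absurd he (hturn _ rfl)
  · exact absurd he (hturn _ rfl)
  · exact absurd he (hturn _ (Flag.opp_hyp _))
  · exact absurd he (hturn _ (by rw [Flag.rev_edge, Flag.opp_hyp]))

theorem eq_of_half_eq {d d' : Flag X} (h : d.half = d'.half)
    (h' : idx d.opp.edge = idx d'.opp.edge) : d = d' := by
  have he := Flag.edge_eq_of_half_eq h
  refine hi.eq_of_sq_eq (hi.sq he (hi.inj ?_ h')) h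
  rw [Flag.opp_hyp, Flag.opp_hyp, he]

/-- At most two squares meet at a 1-cell: the opposite 1-cell has an adjacent index, leaving two
possibilities, and each determines the flag by `eq_of_half_eq`. -/
theorem eq_flip {d d' : Flag X} (h : d'.half = d.half) : d' = d ∨ d' = d.flip := by
  by_contra! hcon
  have h1 := d.flip_half
  have h2 : d.flip ≠ d := fun hf => hcon.1 (Flag.IsFree.eq hf h)
  have o1 := hi.opp d
  have o2 := hi.opp d'
  have o3 := hi.opp d.flip
  rw [Flag.flip_edge] at o3
  rw [Flag.edge_eq_of_half_eq h] at o2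
  have n1 : idx d.flip.opp.edge ≠ idx d.opp.edge := fun h' => h2 (hi.eq_of_half_eq h1 h')
  have n2 : idx d'.opp.edge ≠ idx d.opp.edge := fun h' => hcon.1 (hi.eq_of_half_eq h h')
  have n3 : idx d'.opp.edge ≠ idx d.flip.opp.edge :=
    fun h' => hcon.2 (hi.eq_of_half_eq (h.trans h1.symm) h')
  omega

theorem flip_flip (d : Flag X) : d.flip.flip = d := by
  rcases hi.eq_flip (d := d) (d' := d.flip.flip) (by simp only [Flag.flip_half]) with h | h
  · exact h
  · have : d.flip.IsFree := h
    have h1 : d = d.flip := this.eq d.flip_half.symm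
    rw [h, ← h1]

theorem isFree_flip {d : Flag X} (h : d.flip.IsFree) : d.IsFree :=
  (h.symm.trans (hi.flip_flip d))

end IsHypIndex

/-! ### Rays -/

namespace Flag

open Classical in
/-- Go across the side of the flag into the next square, to the opposite side there. -/
noncomputable def step (d : Flag X) : Flag X := if d.IsFree then d else d.flip.opp

theorem step_of_isFree {d : Flag X} (h : d.IsFree) : d.step = d := if_pos h

theorem step_of_not_isFree {d : Flag X} (h : ¬ d.IsFree) : d.step = d.flip.opp := if_neg h

/-- The hyperplane dual to the side of `d` crosses `a` after leaving the square of `d` through the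
side of `d`, or `a` is this side. -/
def InRay (d : Flag X) (a : X.E) : Prop := ∃ j, (step^[j] d).edge = a

theorem step_hyp (d : Flag X) : X.hyp d.step.edge = X.hyp d.edge := by
  by_cases h : d.IsFree
  · rw [step_of_isFree h]
  · rw [step_of_not_isFree h, opp_hyp, flip_edge]

theorem iterate_step_hyp (d : Flag X) (j : ℕ) : X.hyp (step^[j] d).edge = X.hyp d.edge := by
  induction j with
  | zero => rfl
  | succ j ih => rw [Function.iterate_succ_apply', step_hyp, ih]

theorem InRay.hyp {d : Flag X} {a : X.E} (h : d.InRay a) : X.hyp a = X.hyp d.edge := by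
  obtain ⟨j, rfl⟩ := h
  exact d.iterate_step_hyp j

theorem iterate_step_of_isFree {d : Flag X} {i j : ℕ} (h : (step^[i] d).IsFree) (hij : i ≤ j) :
    step^[j] d = step^[i] d := by
  obtain ⟨k, rfl⟩ := Nat.exists_eq_add_of_le hij
  rw [add_comm, Function.iterate_add_apply]
  exact Function.iterate_fixed (step_of_isFree h) k

/-- `n` is the number of squares which the ray of `d` crosses. -/
def RayLength (d : Flag X) (n : ℕ) : Prop :=
  (step^[n] d).IsFree ∧ ∀ j < n, ¬ (step^[j] d).IsFree

theorem RayLength.step_eq {d : Flag X} {n j : ℕ} (h : d.RayLength n) (hj : j < n) :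
    step^[j + 1] d = (step^[j] d).flip.opp := by
  rw [Function.iterate_succ_apply', step_of_not_isFree (h.2 j hj)]

theorem RayLength.exists_le {d : Flag X} {n : ℕ} (h : d.RayLength n) (j : ℕ) :
    ∃ i ≤ n, step^[j] d = step^[i] d := by
  rcases le_total j n with hj | hj
  · exact ⟨j, hj, rfl⟩
  · exact ⟨n, le_rfl, iterate_step_of_isFree h.1 hj⟩

theorem RayLength.edge_eq {d z : Flag X} {n : ℕ} (h : d.RayLength n) (hz : z.IsFree)
    (hd : d.InRay z.edge) : (step^[n] d).edge = z.edge := by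
  obtain ⟨j, hj⟩ := hd
  obtain ⟨i, hi, hij⟩ := h.exists_le j
  rw [hij] at hj
  have hf : (step^[i] d).IsFree := by
    rcases hz.eq_or_of_edge_eq hj with h1 | h1 <;> rw [h1]
    · exact hz
    · exact hz.rev
  rw [iterate_step_of_isFree hf hi, hj]

end Flag

namespace IsHypIndex

variable (hi : X.IsHypIndex idx)
include hi

theorem dir_step {d : Flag X} (h : ¬ d.IsFree) :
    (idx d.step.edge : ℤ) = idx d.edge + (idx d.edge - idx d.opp.edge) ∧
      d.step.opp.edge = d.edge := by
  rw [Flag.step_of_not_isFree h, Flag.opp_opp, Flag.flip_edge]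
  refine ⟨?_, rfl⟩
  have o1 := hi.opp d
  have o2 := hi.opp d.flip
  rw [Flag.flip_edge] at o2
  have n1 : idx d.flip.opp.edge ≠ idx d.opp.edge :=
    fun h' => h (hi.eq_of_half_eq d.flip_half h')
  omega

/-- The difference `idx d.edge - idx d.opp.edge` is `1` or `-1` and persists along the ray, so the
index is an affine function of the number of steps. Termination, injectivity and disjointness of
opposite rays follow by arithmetic. -/
theorem idx_iterate {d : Flag X} {n : ℕ} (h : ∀ j < n, ¬ (Flag.step^[j] d).IsFree) :
    (idx (Flag.step^[n] d).edge : ℤ) = idx d.edge + n * (idx d.edge - idx d.opp.edge) ∧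
    (idx (Flag.step^[n] d).opp.edge : ℤ) =
      idx d.edge + n * (idx d.edge - idx d.opp.edge) - (idx d.edge - idx d.opp.edge) := by
  induction n with
  | zero => simp
  | succ n ih =>
    obtain ⟨h1, h2⟩ := ih fun j hj => h j (by omega)
    obtain ⟨h3, h4⟩ := hi.dir_step (h n (by omega))
    rw [Function.iterate_succ_apply', h4, h3]
    push_cast
    constructor <;> linarith

theorem exists_rayLength [Finite X.E] (d : Flag X) : ∃ n, d.RayLength n := by
  classical
  have hex : ∃ n, (Flag.step^[n] d).IsFree := by
    by_contra! hcon
    refine not_injective_infinite_finite (fun j => (Flag.step^[j] d).edge) fun i j hij => ?_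
    have e1 := (hi.idx_iterate (n := i) fun j _ => hcon j).1
    have e2 := (hi.idx_iterate (n := j) fun j _ => hcon j).1
    simp only at hij
    rw [hij, e2] at e1
    rcases hi.opp d with h | h <;> rw [h] at e1 <;> push_cast at e1 <;> lia
  exact ⟨Nat.find hex, Nat.find_spec hex, fun j hj => Nat.find_min hex hj⟩

theorem idx_add_eq {z z' : Flag X} (hs : z.sq = z'.sq) (hh : X.hyp z.edge = X.hyp z'.edge) :
    idx z.edge + idx z.opp.edge = idx z'.edge + idx z'.opp.edge := by
  rcases Flag.eq_or_of_sq_eq hs with rfl | rfl | rfl | rfl | rfl | rfl | rfl | rfl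
  · rfl
  · rfl
  · rw [Flag.opp_opp, add_comm]
  · rw [Flag.opp_rev, Flag.opp_opp, add_comm]; rfl
  · exact absurd hh.symm (hi.turn z)
  · exact absurd hh.symm (hi.turn z)
  · rw [Flag.opp_hyp] at hh
    exact absurd hh.symm (hi.turn z)
  · rw [Flag.rev_edge, Flag.opp_hyp] at hh
    exact absurd hh.symm (hi.turn z)

/-- A hyperplane passes through each square at most once. -/
theorem sq_injective {d : Flag X} {n i j : ℕ} (h : d.RayLength n) (hin : i ≤ n) (hjn : j ≤ n)
    (hs : (Flag.step^[i] d).sq = (Flag.step^[j] d).sq) : i = j := by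
  have e := hi.idx_add_eq hs (by rw [Flag.iterate_step_hyp, Flag.iterate_step_hyp])
  obtain ⟨a1, a2⟩ := hi.idx_iterate (n := i) fun k hk => h.2 k (by omega)
  obtain ⟨b1, b2⟩ := hi.idx_iterate (n := j) fun k hk => h.2 k (by omega)
  rcases hi.opp d with h | h <;> rw [h] at a1 a2 b1 b2 <;> push_cast at * <;> lia

theorem edge_injective {d : Flag X} {n i j : ℕ} (h : d.RayLength n) (hin : i ≤ n) (hjn : j ≤ n)
    (hs : (Flag.step^[i] d).edge = (Flag.step^[j] d).edge) : i = j := by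
  obtain ⟨a1, a2⟩ := hi.idx_iterate (n := i) fun k hk => h.2 k (by omega)
  obtain ⟨b1, b2⟩ := hi.idx_iterate (n := j) fun k hk => h.2 k (by omega)
  rw [hs] at a1
  rcases hi.opp d with h | h <;> rw [h] at a1 a2 b1 b2 <;> push_cast at * <;> lia

theorem sq_ne_of_opp {d : Flag X} {n n' i j : ℕ} (h : d.RayLength n) (h' : d.opp.RayLength n')
    (hin : i < n) (hjn : j < n') : (Flag.step^[i + 1] d).sq ≠ (Flag.step^[j + 1] d.opp).sq := by
  intro hs
  have e := hi.idx_add_eq hs (by rw [Flag.iterate_step_hyp, Flag.iterate_step_hyp, Flag.opp_hyp])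
  obtain ⟨a1, a2⟩ := hi.idx_iterate (n := i + 1) fun k hk => h.2 k (by omega)
  obtain ⟨b1, b2⟩ := hi.idx_iterate (n := j + 1) fun k hk => h'.2 k (by omega)
  rw [Flag.opp_opp] at b1 b2
  rcases hi.opp d with h | h <;> rw [h] at a1 a2 b1 b2 <;> push_cast at * <;> lia

theorem not_inRay_opp [Finite X.E] {d : Flag X} {a : X.E} (h : d.InRay a) : ¬ d.opp.InRay a := by
  rintro ⟨j, hj⟩
  obtain ⟨i, rfl⟩ := h
  obtain ⟨n, hn⟩ := hi.exists_rayLength d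
  obtain ⟨n', hn'⟩ := hi.exists_rayLength d.opp
  obtain ⟨i, hin, e1⟩ := hn.exists_le i
  obtain ⟨j, hjn, e2⟩ := hn'.exists_le j
  rw [e1, e2] at hj
  obtain ⟨a1, a2⟩ := hi.idx_iterate (n := i) fun k hk => hn.2 k (by omega)
  obtain ⟨b1, b2⟩ := hi.idx_iterate (n := j) fun k hk => hn'.2 k (by omega)
  rw [hj] at b1
  rw [Flag.opp_opp] at b1 b2
  rcases hi.opp d with h | h <;> rw [h] at a1 a2 b1 b2 <;> push_cast at * <;> lia

/-- The two rays of a square cover the hyperplane. -/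
theorem inRay_or_of_hyp_eq [Finite X.E] {d : Flag X} {a : X.E} (h : X.hyp a = X.hyp d.edge) :
    d.InRay a ∨ d.opp.InRay a := by
  have key : ∀ (d : Flag X) (a : X.E) (m : ℕ), X.hyp a = X.hyp d.edge →
      (idx a : ℤ) = idx d.edge + m * (idx d.edge - idx d.opp.edge) → d.InRay a := by
    intro d a m ha hm
    obtain ⟨n, hn⟩ := hi.exists_rayLength d
    rcases le_or_gt m n with hmn | hmn
    · refine ⟨m, hi.inj ?_ ?_⟩
      · rw [Flag.iterate_step_hyp, ha]
      · have := (hi.idx_iterate (n := m) fun k hk => hn.2 k (by omega)).1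
        omega
    · exfalso
      obtain ⟨c1, c2⟩ := hi.idx_iterate (n := n) fun k hk => hn.2 k (by omega)
      set z := Flag.step^[n] d with hz
      have hzh : X.hyp z.edge = X.hyp d.edge := d.iterate_step_hyp n
      have hfree : z.IsFree := hn.1
      -- the next dual 1-cell beyond `z`
      obtain ⟨w, hw1, hw2⟩ : ∃ w : Flag X, w.edge = z.edge ∧
          (idx w.opp.edge : ℤ) = idx z.edge + (idx d.edge - idx d.opp.edge) := by
        rcases hi.opp d with h | h
        · have hlt : idx z.edge ≥ 1 ∧ idx a ≤ idx z.edge - 1 := by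
            rw [h] at hm c1; push_cast at hm c1; constructor <;> lia
          obtain ⟨b, hb, hb'⟩ := hi.pred z.edge (idx z.edge - 1) (by omega)
          obtain ⟨f, hf1, hf2⟩ := hi.succ hb (by omega)
          refine ⟨f.opp, hf2, ?_⟩
          rw [Flag.opp_opp, hf1]
          omega
        · have hlt : idx z.edge + 1 ≤ idx a := by
            rw [h] at hm c1; push_cast at hm c1; lia
          obtain ⟨b, hb, hb'⟩ := hi.pred a (idx z.edge + 1) hlt
          obtain ⟨f, hf1, hf2⟩ := hi.succ (a := z.edge) (b := b) (by rw [hb, ha, hzh]) hb'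
          refine ⟨f, hf1, ?_⟩
          rw [hf2]
          omega
      have hopp : w.opp.edge = z.opp.edge := by
        rcases hfree.eq_or_of_edge_eq hw1 with h1 | h1 <;> rw [h1]
        rfl
      rw [hopp] at hw2
      have := hi.opp d
      omega
  have hd := hi.opp d
  have hab : ∀ x y : ℤ, x = y + (x - y).toNat ∨ x = y - ((y - x).toNat : ℤ) := by
    intro x y; omega
  rcases hd with hd | hd
  · rcases le_or_gt (idx a) (idx d.edge) with hle | hle
    · left
      refine key d a (idx d.edge - idx a) h ?_
      rw [hd]; push_cast [hle]; ring
    · right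
      refine key d.opp a (idx a - idx d.opp.edge) (by rw [h, Flag.opp_hyp]) ?_
      rw [Flag.opp_opp, hd]
      have : idx d.edge + 1 ≤ idx a := hle
      push_cast [this]; ring
  · rcases le_or_gt (idx d.edge) (idx a) with hle | hle
    · left
      refine key d a (idx a - idx d.edge) h ?_
      rw [hd]; rw [hd] at hle; push_cast [hle]; ring
    · right
      refine key d.opp a (idx d.opp.edge - idx a) (by rw [h, Flag.opp_hyp]) ?_
      rw [Flag.opp_opp, hd]
      have : idx a ≤ idx d.opp.edge := by omega
      push_cast [this]; ring

/-- The ray that enters the square of a free side `d` through `d` and turns there separates the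
vertices into two classes. -/
theorem exists_rayColoring [Finite X.E] [ContractibleSpace X.Realization] {d : Flag X}
    (hd : d.IsFree) : ∃ χ : X.V → Bool, χ d.src = true ∧
      ∀ z : Flag X, χ z.src ≠ χ z.rev.src ↔ z.edge = d.edge ∨ d.turn.InRay z.edge := by
  classical
  obtain ⟨n, hn⟩ := hi.exists_rayLength d.turn
  -- `S` is the bank of the curve on the side of `d.src`. The involution `g` below turns in the
  -- square of `d` and goes straight elsewhere; this is consistent because the ray never returns to
  -- that square.
  let S : Set (X.E × Bool) := {x | x = d.half ∨ ∃ j ≤ n, x = (Flag.step^[j] d.turn).half}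
  let g : Flag X → Flag X := fun z => if z.sq = d.sq then z.turn else z.opp
  have hne : ∀ j ≤ n, j ≠ 0 → (Flag.step^[j] d.turn).sq ≠ d.sq := fun j hj hj0 hs =>
    hj0 (hi.sq_injective (i := j) (j := 0) hn hj (by omega) hs)
  have hx : ∀ j ≤ n, (g (Flag.step^[j] d.turn)).half ∈ S := by
    intro j hj
    rcases Nat.eq_zero_or_pos j with rfl | hpos
    · simp [g, S]
    · obtain ⟨j, rfl⟩ := Nat.exists_eq_add_of_le' hpos
      simp only [g, if_neg (hne (j + 1) hj (by omega))]
      rw [hn.step_eq (by omega), Flag.opp_opp, Flag.flip_half]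
      exact .inr ⟨j, by omega, rfl⟩
  obtain ⟨χ, hχ⟩ := exists_coloring S g (fun z => by simp only [g]; split_ifs <;> rfl)
    (fun z => by simp only [g]; split_ifs <;> rfl)
    (fun z => by
      simp only [g]
      split_ifs with h1 h2 h2
      · simp
      · exact absurd h1 h2
      · exact absurd h2 h1
      · simp)
    (by
      rintro z (hz | ⟨j, hj, hz⟩)
      · obtain rfl := hd.eq hz
        simp only [g, if_true]
        exact .inr ⟨0, by omega, rfl⟩
      · rcases hi.eq_flip hz with rfl | rfl
        · exact hx j hj
        · rcases hj.lt_or_eq with hj | rfl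
          · have hsq := hne (j + 1) hj (by omega)
            rw [hn.step_eq hj] at hsq
            rw [Flag.opp_sq] at hsq
            simp only [g, if_neg hsq]
            exact .inr ⟨j + 1, hj, by rw [hn.step_eq hj]⟩
          · rw [hn.1]
            exact hx j le_rfl)
  have hch : ∀ z : Flag X, χ z.src ≠ χ z.rev.src ↔ z.edge = d.edge ∨ d.turn.InRay z.edge := by
    intro z
    -- The curve crosses each 1-cell at most once, so `S` never contains both ends and every crossed
    -- 1-cell does change colour.
    have hS : ∀ b, (z.edge, b) ∈ S → (z.edge, !b) ∉ S := by
      rintro b (h1 | ⟨j, hj, h1⟩) (h2 | ⟨i, hin, h2⟩)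
      · have := (Prod.ext_iff.1 (h1.trans h2.symm)).2
        simp at this
      · have e1 : z.edge = d.edge := (Prod.ext_iff.1 h1).1
        have e2 : z.edge = _ := (Prod.ext_iff.1 h2).1
        refine hi.turn d ?_
        rw [← e1, e2]
        exact (Flag.iterate_step_hyp _ _).symm
      · have e1 : z.edge = d.edge := (Prod.ext_iff.1 h2).1
        have e2 : z.edge = _ := (Prod.ext_iff.1 h1).1
        refine hi.turn d ?_
        rw [← e1, e2]
        exact (Flag.iterate_step_hyp _ _).symm
      · have e1 : z.edge = _ := (Prod.ext_iff.1 h1).1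
        have e2 : z.edge = _ := (Prod.ext_iff.1 h2).1
        obtain rfl := hi.edge_injective hn hj hin (e1.symm.trans e2)
        have := (Prod.ext_iff.1 (h1.trans h2.symm)).2
        simp at this
    have h1 : z.rev.src = X.ends z.edge (!z.half.2) := by
      rw [Flag.src, Flag.half_rev]; rfl
    have h2 : z.src = X.ends z.edge z.half.2 := rfl
    rw [h1, h2, hχ]
    constructor
    · rintro (⟨h | ⟨j, -, h⟩, -⟩ | ⟨h | ⟨j, -, h⟩, -⟩)
      · exact .inl ((Prod.ext_iff.1 h).1)
      · exact .inr ⟨j, (Prod.ext_iff.1 h).1.symm⟩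
      · exact .inl ((Prod.ext_iff.1 h).1)
      · exact .inr ⟨j, (Prod.ext_iff.1 h).1.symm⟩
    · intro h
      have : ∃ b, (z.edge, b) ∈ S := by
        rcases h with h | ⟨j, h⟩
        · exact ⟨d.half.2, .inl (Prod.ext h rfl)⟩
        · obtain ⟨i, hin, hij⟩ := hn.exists_le j
          rw [hij] at h
          exact ⟨(Flag.step^[i] d.turn).half.2, .inr ⟨i, hin, Prod.ext h.symm rfl⟩⟩
      obtain ⟨b, hb⟩ := this
      have hb' := hS b hb
      by_cases hbz : b = z.half.2
      · subst hbz
        exact .inl ⟨hb, hb'⟩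
      · have : b = !z.half.2 := by
          revert hbz; cases b <;> cases z.half.2 <;> simp
        subst this
        rw [Bool.not_not] at hb'
        exact .inr ⟨hb, hb'⟩
  refine ⟨fun v => χ v == χ d.src, by simp, fun z => ?_⟩
  rw [← hch]
  change ((χ z.src == χ d.src) ≠ (χ z.rev.src == χ d.src)) ↔ _
  generalize χ z.src = a, χ z.rev.src = b, χ d.src = c
  revert a b c; decide

end IsHypIndex

/-- If `(ac)^k x = c x`, cancelling a letter at either end of the word lowers `k` by two; one is
left with a fixed point of `c` or of `a`, depending on the parity of `k`. -/
theorem iterate_ne_of_involutive {α : Type*} {a c : α → α} (ha : Function.Involutive a)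
    (hc : Function.Involutive c) (ha' : ∀ x, a x ≠ x) (hc' : ∀ x, c x ≠ x) (k : ℕ) :
    ∀ x, (fun y => a (c y))^[k] x ≠ c x := by
  induction k using Nat.twoStepInduction with
  | zero => exact fun x h => hc' x h.symm
  | one => exact fun x => ha' (c x)
  | more k ih _ =>
    intro x h
    rw [Function.iterate_succ_apply, Function.iterate_succ_apply'] at h
    have h1 := congrArg c (congrArg a h)
    rw [ha, hc] at h1
    exact ih (a (c x)) h1

/-! ### Walking along the boundary -/

namespace Flag

open Classical in
/-- the reversed flag if the side of `d` is free, and the flag across this side otherwise -/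
noncomputable def cross (d : Flag X) : Flag X := if d.IsFree then d.rev else d.flip

/-- Starting with a free side, this walk goes along the boundary component of that side; at each
vertex it passes through all the squares between two consecutive free sides. -/
noncomputable def walk (d : Flag X) (t : ℕ) : Flag X := (fun z => z.cross.turn)^[t] d

/-- the period of the boundary walk -/
noncomputable def perim (d : Flag X) : ℕ := Function.minimalPeriod (fun z => z.cross.turn) d

theorem cross_of_isFree {d : Flag X} (h : d.IsFree) : d.cross = d.rev := if_pos h

theorem cross_of_not_isFree {d : Flag X} (h : ¬ d.IsFree) : d.cross = d.flip := if_neg h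

theorem walk_succ (d : Flag X) (t : ℕ) : d.walk (t + 1) = (d.walk t).cross.turn :=
  Function.iterate_succ_apply' _ _ _

theorem walk_succ_of_isFree {d : Flag X} {t : ℕ} (h : (d.walk t).IsFree) :
    d.walk (t + 1) = (d.walk t).rev.turn := by
  rw [walk_succ, cross_of_isFree h]

theorem walk_add (d : Flag X) (s t : ℕ) : d.walk (s + t) = (d.walk t).walk s :=
  Function.iterate_add_apply _ _ _ _

@[simp] theorem walk_add_perim (d : Flag X) (t : ℕ) : d.walk (t + d.perim) = d.walk t :=
  Function.iterate_add_minimalPeriod_eq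

theorem walk_succ_src {d : Flag X} {t : ℕ} (h : (d.walk t).IsFree) :
    (d.walk (t + 1)).src = (d.walk t).rev.src := by
  rw [walk_succ_of_isFree h, turn_src]

theorem walk_succ_src_of_not {d : Flag X} {t : ℕ} (h : ¬ (d.walk t).IsFree) :
    (d.walk (t + 1)).src = (d.walk t).src := by
  rw [walk_succ, cross_of_not_isFree h, turn_src, flip_src]

/-- `C` is the set of 1-cells at whose ends the colouring `χ` differs. -/
def ChangesAt (χ : X.V → Bool) (C : X.E → Prop) : Prop :=
  ∀ z : Flag X, χ z.src ≠ χ z.rev.src ↔ C z.edge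

theorem ChangesAt.walk_eq {χ : X.V → Bool} {C : X.E → Prop} (hχ : ChangesAt χ C) {d : Flag X}
    {a b : ℕ} (hab : a ≤ b) (h : ∀ i, a ≤ i → i < b → (d.walk i).IsFree → ¬ C (d.walk i).edge) :
    χ (d.walk b).src = χ (d.walk a).src := by
  induction b, hab using Nat.le_induction with
  | base => rfl
  | succ b hab ih =>
    rw [← ih fun i h1 h2 => h i h1 (by omega)]
    by_cases hf : (d.walk b).IsFree
    · rw [walk_succ_src hf]
      by_contra hne
      exact h b hab (by omega) hf ((hχ _).1 (Ne.symm hne))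
    · rw [walk_succ_src_of_not hf]

theorem ChangesAt.exists_of_ne {χ : X.V → Bool} {C : X.E → Prop} (hχ : ChangesAt χ C)
    {y : Flag X} {n a b : ℕ} (hn : y.RayLength n) (hab : a ≤ b) (hbn : b ≤ n)
    (hne : χ (step^[a] y).src ≠ χ (step^[b] y).src) :
    ∃ j, a ≤ j ∧ j < b ∧ C (step^[j + 1] y).turn.edge := by
  by_contra! hcon
  apply hne
  clear hne
  induction b, hab using Nat.le_induction with
  | base => rfl
  | succ b hab ih =>
    rw [ih (by omega) fun j h1 h2 => hcon j h1 (by omega)]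
    by_contra hne
    apply hcon b hab (by omega)
    rw [hn.step_eq (by omega), ← turn_rev_turn, turn_turn, rev_edge]
    refine (hχ _).1 ?_
    rw [hn.step_eq (by omega), ← turn_rev_turn, turn_src] at hne
    rwa [turn_src, flip_src]

/-- A ray that changes colour for a ray colouring of another hyperplane crosses the latter. -/
theorem ChangesAt.exists_crossing {χ : X.V → Bool} {z : Flag X} (hz : z.IsFree)
    (hχ : ChangesAt χ fun a => a = z.edge ∨ z.turn.InRay a) {y : Flag X}
    (hyz : X.hyp y.edge ≠ X.hyp z.turn.edge) {n a b : ℕ} (hn : y.RayLength n) (hab : a ≤ b)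
    (hbn : b ≤ n) (hne : χ (step^[a] y).src ≠ χ (step^[b] y).src) :
    ∃ j, a ≤ j ∧ j < b ∧ z.turn.InRay (step^[j + 1] y).turn.edge ∧
      (step^[j + 1] y).sq ∈ X.crossings (X.hyp y.edge) (X.hyp z.turn.edge) := by
  obtain ⟨j, h1, h2, h3⟩ := hχ.exists_of_ne hn hab hbn hne
  have h4 : z.turn.InRay (step^[j + 1] y).turn.edge := by
    refine h3.resolve_left fun h => hyz ?_
    rw [← iterate_step_hyp y (j + 1)]
    rcases hz.eq_or_of_edge_eq h with h | h
    · rw [← h, turn_turn]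
    · rw [← rev_turn_hyp, ← h, turn_turn]
  refine ⟨j, h1, h2, h4, ?_⟩
  have := sq_mem_crossings (step^[j + 1] y)
  rwa [iterate_step_hyp, h4.hyp] at this

end Flag

namespace IsHypIndex

variable (hi : X.IsHypIndex idx)
include hi

theorem cross_cross (d : Flag X) : d.cross.cross = d := by
  by_cases h : d.IsFree
  · rw [Flag.cross_of_isFree h, Flag.cross_of_isFree h.rev, Flag.rev_rev]
  · rw [Flag.cross_of_not_isFree h, Flag.cross_of_not_isFree (fun h' => h (hi.isFree_flip h')),
      hi.flip_flip]

/-- The boundary walk traverses a free side in one direction only. Hence it meets the 1-cell of that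
side once in each round. -/
theorem walk_ne_rev {d : Flag X} {t : ℕ} (h : d.IsFree) : d.walk t ≠ d.rev := by
  rw [← Flag.cross_of_isFree h]
  refine iterate_ne_of_involutive (a := Flag.turn) (c := Flag.cross) Flag.turn_turn
    hi.cross_cross Flag.turn_ne
    (fun x hx => ?_) t d
  by_cases hf : x.IsFree
  · rw [Flag.cross_of_isFree hf] at hx
    exact x.rev_ne hx
  · rw [Flag.cross_of_not_isFree hf] at hx
    exact hf hx

theorem walk_injective (t : ℕ) : Function.Injective fun d : Flag X => d.walk t := by
  refine Function.Injective.iterate (fun a b hab => ?_) t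
  have h1 : a.cross = b.cross := by
    rw [← a.cross.turn_turn, ← b.cross.turn_turn]
    exact congrArg Flag.turn hab
  rw [← hi.cross_cross a, ← hi.cross_cross b, h1]

theorem perim_pos [Finite X.Q] (d : Flag X) : 0 < d.perim := by
  refine Function.minimalPeriod_pos_of_mem_periodicPts ?_
  exact Function.Injective.mem_periodicPts (hi.walk_injective 1) d

theorem walk_ne {d : Flag X} {s t : ℕ} (h1 : s < t) (h2 : t < s + d.perim) :
    d.walk t ≠ d.walk s := by
  intro h
  have h3 : d.walk (t - s) = d := by
    refine hi.walk_injective s ?_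
    change (d.walk (t - s)).walk s = d.walk s
    rw [← Flag.walk_add, Nat.add_sub_of_le h1.le, h]
  exact Function.not_isPeriodicPt_of_pos_of_lt_minimalPeriod (by omega)
    (show t - s < d.perim by omega) h3

theorem walk_edge_ne {d : Flag X} {s t : ℕ} (hs : (d.walk s).IsFree) (h1 : s < t)
    (h2 : t < s + d.perim) : (d.walk t).edge ≠ (d.walk s).edge := by
  intro h
  rcases hs.eq_or_of_edge_eq h with h | h
  · exact hi.walk_ne h1 h2 h
  · rw [← Nat.sub_add_cancel h1.le, Flag.walk_add] at h
    exact hi.walk_ne_rev hs h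

end IsHypIndex

/-! ### Where the rays of a boundary walk end -/

namespace Flag

/-- The ray that enters through the free side `z` and turns there ends at the `i`-th flag of the
boundary walk of `d`, within the first round after time `t`. -/
structure Lands (d z : Flag X) (t i : ℕ) : Prop where
  lt : t < i
  lt_add : i < t + d.perim
  isFree : (d.walk i).IsFree
  inRay : z.turn.InRay (d.walk i).edge

end Flag

namespace IsHypIndex

variable (hi : X.IsHypIndex idx)
include hi

/-- The walk changes colour when it passes the side at which the curve enters. It must change back
before closing up, and the only other place on the boundary where it can do so is the end of the
ray. -/
theorem exists_lands [Finite X.E] [Finite X.Q] [ContractibleSpace X.Realization] {d z : Flag X}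
    {t : ℕ} (ht : (d.walk t).IsFree) (hz : z.IsFree) (hzt : z.edge = (d.walk t).edge) :
    ∃ i, d.Lands z t i := by
  obtain ⟨χ, -, hχ⟩ := hi.exists_rayColoring hz
  by_contra! hcon
  have hm := hi.perim_pos d
  have h1 : Flag.ChangesAt χ fun a => a = z.edge ∨ z.turn.InRay a := hχ
  have h2 := h1.walk_eq (d := d) (a := t + 1) (b := t + d.perim) (by omega) (by
    rintro i hi1 hi2 hif (h | h)
    · exact hi.walk_edge_ne ht (by omega) hi2 (h.trans hzt)
    · exact hcon i ⟨by omega, hi2, hif, h⟩)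
  rw [Flag.walk_add_perim, Flag.walk_succ_src ht] at h2
  exact (hχ (d.walk t)).2 (.inl hzt.symm) h2

theorem lands_unique [Finite X.E] {d z : Flag X} {t i j : ℕ} (h : d.Lands z t i)
    (h' : d.Lands z t j) : i = j := by
  obtain ⟨n, hn⟩ := hi.exists_rayLength z.turn
  have e := (hn.edge_eq h.isFree h.inRay).symm.trans (hn.edge_eq h'.isFree h'.inRay)
  have := h.lt
  have := h'.lt
  have := h.lt_add
  have := h'.lt_add
  rcases lt_trichotomy i j with hij | hij | hij
  · exact absurd e.symm (hi.walk_edge_ne h.isFree hij (by omega))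
  · exact hij
  · exact absurd e (hi.walk_edge_ne h'.isFree hij (by omega))

theorem walk_color_of_le [Finite X.E] {d z : Flag X} {t i j : ℕ} {χ : X.V → Bool}
    (hχ : Flag.ChangesAt χ fun a => a = z.edge ∨ z.turn.InRay a) (ht : (d.walk t).IsFree)
    (hzt : z.edge = (d.walk t).edge) (h : d.Lands z t i) (h1 : t < j) (h2 : j ≤ i) :
    χ (d.walk j).src = χ (d.walk t).rev.src := by
  rw [← Flag.walk_succ_src ht]
  have := h.lt_add
  refine hχ.walk_eq h1 ?_
  rintro k hk1 hk2 hkf (hk | hk)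
  · exact hi.walk_edge_ne ht hk1 (by omega) (hk.trans hzt)
  · have := hi.lands_unique h ⟨hk1, by omega, hkf, hk⟩
    omega

theorem walk_color_of_lt [Finite X.E] {d z : Flag X} {t i j : ℕ} {χ : X.V → Bool}
    (hχ : Flag.ChangesAt χ fun a => a = z.edge ∨ z.turn.InRay a) (ht : (d.walk t).IsFree)
    (hzt : z.edge = (d.walk t).edge) (h : d.Lands z t i) (h1 : i < j) (h2 : j ≤ t + d.perim) :
    χ (d.walk j).src = χ (d.walk t).src := by
  rw [← d.walk_add_perim t]
  have := h.lt
  refine (hχ.walk_eq h2 ?_).symm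
  rintro k hk1 hk2 hkf (hk | hk)
  · exact hi.walk_edge_ne ht (by omega) (by omega) (hk.trans hzt)
  · have := hi.lands_unique h ⟨by omega, by omega, hkf, hk⟩
    omega

/-- A hyperplane does not cross itself, so its own ray colouring is constant along it. -/
theorem color_iterate_step {z y : Flag X} {χ : X.V → Bool} (hz : z.IsFree)
    (hχ : Flag.ChangesAt χ fun a => a = z.edge ∨ z.turn.InRay a) (hsq : y.sq = z.sq)
    (hy : X.hyp y.edge = X.hyp z.turn.edge) {n i : ℕ} (hn : y.RayLength n) (hin : i ≤ n) :
    χ (Flag.step^[i] y).src = χ y.src := by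
  by_contra hne
  obtain ⟨j, -, hj, h⟩ := hχ.exists_of_ne hn (a := 0) (b := i) (Nat.zero_le _) hin (Ne.symm hne)
  rcases h with h | h
  · have hs : (Flag.step^[j + 1] y).sq = y.sq := by
      rw [hsq, ← Flag.turn_sq]
      rcases hz.eq_or_of_edge_eq h with h1 | h1 <;> rw [h1]
      rfl
    have := hi.sq_injective (i := j + 1) (j := 0) hn (by omega) (by omega) hs
    omega
  · apply hi.turn (Flag.step^[j + 1] y)
    rw [h.hyp, Flag.iterate_step_hyp, hy]

/-- The right ray of a free side lands before the left ray. -/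
theorem lands_right_lt_left [Finite X.E] [ContractibleSpace X.Realization] {d : Flag X}
    {t l r : ℕ} (ht : (d.walk t).IsFree) (hl : d.Lands (d.walk t) t l)
    (hr : d.Lands (d.walk t).rev t r) : r < l := by
  obtain ⟨χ, h0, hχ⟩ := hi.exists_rayColoring ht.rev
  have hχ : Flag.ChangesAt χ fun a => a = (d.walk t).rev.edge ∨ (d.walk t).rev.turn.InRay a := hχ
  obtain ⟨n, hn⟩ := hi.exists_rayLength (d.walk t).turn
  have h1 : χ (d.walk t).src = false := by
    have := (hχ (d.walk t)).2 (.inl rfl)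
    rw [h0] at this
    simpa using this
  have h2 : χ (Flag.step^[n] (d.walk t).turn).src = false := by
    rw [hi.color_iterate_step ht.rev hχ (by simp) (Flag.rev_turn_hyp _).symm hn le_rfl,
      Flag.turn_src, h1]
  have h3 : χ (d.walk l).src = false := by
    rcases hl.isFree.eq_or_of_edge_eq (hn.edge_eq hl.isFree hl.inRay) with h | h <;> rw [h] at h2
    · exact h2
    · rw [← h2]
      by_contra hne
      rcases (hχ (d.walk l)).1 hne with h4 | h4
      · exact hi.walk_edge_ne ht hl.lt hl.lt_add h4
      · rw [Flag.turn_rev] at h4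
        exact hi.not_inRay_opp hl.inRay h4
  -- The left ray stays on the side of `(d.walk t).src` of the curve of the right ray, whereas the
  -- walk is on the other side until the right ray lands.
  by_contra! hle
  have h4 := hi.walk_color_of_le hχ ht rfl hr hl.lt hle
  rw [h3, h0] at h4
  simp at h4

/-- The ray arrives with the direction of the walk: its starting vertices keep the colour of
`(d.walk p).rev.src`, while just after `r` the walk has the colour of `(d.walk p).src`. -/
theorem iterate_step_eq_walk [Finite X.E] [ContractibleSpace X.Realization] {d : Flag X}
    {p r n : ℕ} (hp : (d.walk p).IsFree) (hr : d.Lands (d.walk p).rev p r)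
    (hn : (d.walk p).rev.turn.RayLength n) : Flag.step^[n] (d.walk p).rev.turn = d.walk r := by
  obtain ⟨χ, h0, hχ⟩ := hi.exists_rayColoring hp.rev
  have hχ : Flag.ChangesAt χ fun a => a = (d.walk p).rev.edge ∨ (d.walk p).rev.turn.InRay a := hχ
  refine (hr.isFree.eq_or_of_edge_eq (hn.edge_eq hr.isFree hr.inRay)).resolve_right fun h => ?_
  have h1 := hi.color_iterate_step hp.rev hχ (Flag.turn_sq _) rfl hn le_rfl
  rw [h, ← Flag.walk_succ_src hr.isFree, Flag.turn_src,
    hi.walk_color_of_lt hχ hp rfl hr (Nat.lt_succ_self r) hr.lt_add] at h1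
  exact (hχ (d.walk p)).2 (.inl rfl) h1

/-- If the right ray of `p` ends between the foot of the rays of `t` and the end of the right ray
of `t`, then it crosses the hyperplane of the latter twice. -/
theorem exists_two_crossings [Finite X.E] [ContractibleSpace X.Realization] {d : Flag X}
    {p r t l r' n : ℕ} (hp : (d.walk p).IsFree) (hr : d.Lands (d.walk p).rev p r)
    (ht : (d.walk t).IsFree) (hl : d.Lands (d.walk t) t l) (hr' : d.Lands (d.walk t).rev t r')
    (hpt : p < t) (hlp : l ≤ p + d.perim) (htr : t ≤ r) (hrr : r < r')
    (hp' : ¬ (d.walk (p + 1)).IsFree)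
    (hh : X.hyp (d.walk p).rev.turn.edge ≠ X.hyp (d.walk t).turn.edge)
    (hn : (d.walk p).rev.turn.RayLength n) :
    ∃ i < n, ∃ j < n, i ≠ j ∧
      (Flag.step^[i + 1] (d.walk p).rev.turn).sq ∈
        X.crossings (X.hyp (d.walk p).rev.turn.edge) (X.hyp (d.walk t).turn.edge) ∧
      (Flag.step^[j + 1] (d.walk p).rev.turn).sq ∈
        X.crossings (X.hyp (d.walk p).rev.turn.edge) (X.hyp (d.walk t).turn.edge) := by
  have hrl := hi.lands_right_lt_left ht hl hr'
  obtain ⟨χ, h0, hχ⟩ := hi.exists_rayColoring ht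
  have hχ : Flag.ChangesAt χ fun a => a = (d.walk t).edge ∨ (d.walk t).turn.InRay a := hχ
  obtain ⟨ψ, k0, hψ⟩ := hi.exists_rayColoring ht.rev
  have hψ : Flag.ChangesAt ψ fun a => a = (d.walk t).rev.edge ∨ (d.walk t).rev.turn.InRay a := hψ
  have hend := hi.iterate_step_eq_walk hp hr hn
  have hstart : (d.walk p).rev.turn = d.walk (p + 1) := (Flag.walk_succ_of_isFree hp).symm
  have h1 : χ (d.walk p).rev.turn.src = χ (d.walk t).src := by
    rw [hstart, ← d.walk_add_perim (p + 1)]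
    exact hi.walk_color_of_lt hχ ht rfl hl (by omega) (by omega)
  have k1 : ψ (d.walk p).rev.turn.src = ψ (d.walk t).src := by
    rw [hstart, ← d.walk_add_perim (p + 1)]
    exact hi.walk_color_of_lt hψ ht rfl hr' (by omega) (by omega)
  have h2 := (hχ (d.walk t)).2 (.inl rfl)
  have k2 := (hψ (d.walk t)).2 (.inl rfl)
  -- If the ray of `p` ends at the side `t` itself, one crossing is in its last square, the square
  -- of `t`. The vertex before that square already lies across the left curve of `t`, so another
  -- crossing precedes it. If `t < r`, both curves of `t` separate the start of the ray from its
  -- end, and the left and right rays have no 1-cell in common.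
  rcases htr.eq_or_lt with rfl | htr
  · obtain _ | n := n
    · rw [← hstart] at hp'
      exact absurd hn.1 hp'
    have hx : (Flag.step^[n] (d.walk p).rev.turn).src = (Flag.step^[n + 1]
        (d.walk p).rev.turn).turn.rev.src := by
      rw [← Flag.turn_src (Flag.turn _).rev, Flag.turn_rev_turn, hn.step_eq (Nat.lt_succ_self n),
        Flag.opp_opp, Flag.flip_src]
    have h3 := (hχ (d.walk t).turn).2 (.inr ⟨0, rfl⟩)
    rw [Flag.turn_src, ← h1, ← hend, ← hx] at h3
    obtain ⟨j, -, hj, -, hj'⟩ := hχ.exists_crossing ht hh hn (Nat.zero_le n) (Nat.le_succ n) h3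
    refine ⟨j, by omega, n, Nat.lt_succ_self n, hj.ne, hj', ?_⟩
    have := Flag.sq_mem_crossings (Flag.step^[n + 1] (d.walk p).rev.turn)
    rw [Flag.iterate_step_hyp] at this
    rwa [show (d.walk t).turn = (Flag.step^[n + 1] (d.walk p).rev.turn).turn by rw [hend]]
  · have h3 := hi.walk_color_of_le hχ ht rfl hl htr (by omega)
    have k3 := hi.walk_color_of_le hψ ht rfl hr' htr hrr.le
    rw [← h1, ← h3, ← hend] at h2
    rw [← k1, ← k3, ← hend] at k2
    obtain ⟨i, -, hi1, hi2, hi3⟩ := hχ.exists_crossing ht hh hn (Nat.zero_le n) le_rfl h2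
    obtain ⟨j, -, hj1, hj2, hj3⟩ := hψ.exists_crossing ht.rev
      (by rwa [Flag.rev_turn_hyp (d.walk t)]) hn (Nat.zero_le n) le_rfl k2
    rw [Flag.rev_turn_hyp (d.walk t)] at hj3
    refine ⟨i, hi1, j, hj1, ?_, hi3, hj3⟩
    rintro rfl
    rw [Flag.turn_rev] at hj2
    exact hi.not_inRay_opp hi2 hj2

end IsHypIndex

theorem encard_contra {α : Type*} {s : Set α} (hs : s.encard ≤ 2) {a b c : α} (ha : a ∈ s)
    (hb : b ∈ s) (hc : c ∈ s) (hab : a ≠ b) (hac : a ≠ c) (hbc : b ≠ c) : False := by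
  have h : ({a, b, c} : Set α) ⊆ s := by
    rintro x (rfl | rfl | rfl) <;> assumption
  have h1 := (Set.encard_le_encard h).trans hs
  have h2 : ({a, b, c} : Set α).encard = 3 := Set.encard_eq_three.2 ⟨a, b, c, hab, hac, hbc, rfl⟩
  rw [h2] at h1
  exact absurd h1 (by decide)

namespace IsHypIndex

variable (hi : X.IsHypIndex idx)
include hi

section
variable [Finite X.E] [ContractibleSpace X.Realization]
  (hX : ∀ h h', h ≠ h' → (X.crossings h h').encard ≤ 2)
include hX

/-- The left ray of `t` ends at the side `k`, so its hyperplane crosses the one parallel to this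
side in the square of `k`. A right ray of `k` landing at or after `t` would add two crossings. -/
theorem lands_right_of_lands_left {d : Flag X} {k t r r' : ℕ} (hk : (d.walk k).IsFree)
    (ht : (d.walk t).IsFree) (hkt : k < t) (hl : d.Lands (d.walk t) t (k + d.perim))
    (hr : d.Lands (d.walk k).rev k r) (hr' : d.Lands (d.walk t).rev t r')
    (hk' : ¬ (d.walk (k + 1)).IsFree) (hrr : r < r') : r < t := by
  by_contra! htr
  obtain ⟨n, hn⟩ := hi.exists_rayLength (d.walk k).rev.turn
  have h1 := hl.inRay.hyp
  rw [Flag.walk_add_perim] at h1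
  have hne : X.hyp (d.walk k).rev.turn.edge ≠ X.hyp (d.walk t).turn.edge := by
    rw [← h1, Flag.rev_turn_hyp]
    exact hi.turn _
  obtain ⟨i, h2, j, h3, hij, h4, h5⟩ :=
    hi.exists_two_crossings hk hr ht hl hr' hkt le_rfl htr hrr hk' hne hn
  have h6 := Flag.sq_mem_crossings (d.walk k).turn
  rw [Flag.turn_turn, h1, ← Flag.rev_turn_hyp] at h6
  -- The ray starts in the square of `k` and does not come back, so the two crossings along it are
  -- different from the one in that square.
  have h7 : ∀ i < n, (Flag.step^[i + 1] (d.walk k).rev.turn).sq ≠ (d.walk k).turn.sq := by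
    intro i hin h
    have := hi.sq_injective (i := i + 1) (j := 0) hn (by omega) (by omega) h
    omega
  refine encard_contra (hX _ _ hne) h4 h5 h6 (fun h => hij ?_) (h7 i h2) (h7 j h3)
  have := hi.sq_injective hn (by omega) (by omega) h
  omega

/-- The right ray of `p` crosses the hyperplane of `t` twice. If the left ray of `p` landed no later
than that of `t`, it would cross this hyperplane a third time. -/
theorem lt_lands_left {d : Flag X} {k p t l r r' : ℕ} (ht : (d.walk t).IsFree)
    (hp : (d.walk p).IsFree) (hkp : k < p) (hpt : p < t)
    (hl : d.Lands (d.walk t) t (k + d.perim)) (hr' : d.Lands (d.walk t).rev t r')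
    (hr : d.Lands (d.walk p).rev p r) (hl' : d.Lands (d.walk p) p l)
    (hp' : ¬ (d.walk (p + 1)).IsFree) (htr : t ≤ r) (hrr : r < r') : k + d.perim < l := by
  by_contra! hle
  have hrl := hi.lands_right_lt_left ht hl hr'
  have hrl' := hi.lands_right_lt_left hp hl' hr
  have := hr'.lt_add
  have hne : X.hyp (d.walk p).rev.turn.edge ≠ X.hyp (d.walk t).turn.edge := by
    -- If the two hyperplanes coincided, the side at `r` would be dual to the hyperplane of `t`:
    -- impossible at `t` itself, and after `t` it would be a landing of one of the rays of `t`
    -- before `r'`.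
    intro h
    rw [← hr.inRay.hyp] at h
    rcases htr.eq_or_lt with rfl | htr
    · exact hi.turn _ h.symm
    · rcases hi.inRay_or_of_hyp_eq h with h1 | h1
      · have := hi.lands_unique hl ⟨htr, by omega, hr.isFree, h1⟩
        omega
      · rw [← Flag.turn_rev] at h1
        have := hi.lands_unique hr' ⟨htr, by omega, hr.isFree, h1⟩
        omega
  have hlk : l < k + d.perim := by
    refine hle.lt_of_ne fun h => hne ?_
    rw [← hl.inRay.hyp, ← h, hl'.inRay.hyp, Flag.rev_turn_hyp]
  obtain ⟨n, hn⟩ := hi.exists_rayLength (d.walk p).rev.turn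
  obtain ⟨i, h2, j, h3, hij, h4, h5⟩ :=
    hi.exists_two_crossings hp hr ht hl hr' hpt (by omega) htr hrr hp' hne hn
  -- The curve of the left ray of `t` separates `p` from the place where the left ray of `p` lands,
  -- which gives the third crossing.
  obtain ⟨χ, h0, hχ⟩ := hi.exists_rayColoring ht
  have hχ : Flag.ChangesAt χ fun a => a = (d.walk t).edge ∨ (d.walk t).turn.InRay a := hχ
  obtain ⟨n', hn'⟩ := hi.exists_rayLength (d.walk p).turn
  have c0 : χ (d.walk p).turn.src = χ (d.walk t).src := by
    rw [Flag.turn_src, ← d.walk_add_perim p]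
    exact hi.walk_color_of_lt hχ ht rfl hl (by omega) (by omega)
  have c1 : χ (Flag.step^[n'] (d.walk p).turn).src = χ (d.walk t).rev.src := by
    rcases hl'.isFree.eq_or_of_edge_eq (hn'.edge_eq hl'.isFree hl'.inRay) with h | h <;> rw [h]
    · exact hi.walk_color_of_le hχ ht rfl hl (by omega) (by omega)
    · rw [← Flag.walk_succ_src hl'.isFree]
      exact hi.walk_color_of_le hχ ht rfl hl (by omega) (by omega)
  have c2 := (hχ (d.walk t)).2 (.inl rfl)
  rw [← c0, ← c1] at c2
  have hne' := hne
  rw [Flag.rev_turn_hyp] at hne'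
  obtain ⟨i', -, h6, -, h7⟩ := hχ.exists_crossing ht hne' hn' (Nat.zero_le _) le_rfl c2
  rw [← Flag.rev_turn_hyp (d.walk p)] at h7
  rw [Flag.turn_rev] at hn h4 h5
  refine encard_contra (hX _ _ hne) (by rwa [Flag.turn_rev]) (by rwa [Flag.turn_rev]) h7
    (fun h => hij ?_) (hi.sq_ne_of_opp hn' hn h6 h2).symm (hi.sq_ne_of_opp hn' hn h6 h3).symm
  have := hi.sq_injective hn (by omega) (by omega) h
  omega

/-- On a boundary walk starting at a free side there are two consecutive free sides, other than the
last and the first one. -/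
theorem exists_corner_gap [Finite X.Q] {d : Flag X} (hd : d.IsFree) :
    ∃ t, t + 1 < d.perim ∧ (d.walk t).IsFree ∧ (d.walk (t + 1)).IsFree := by
  by_contra! hcon
  have hm := hi.perim_pos d
  choose! lam hlam using fun t (ht : (d.walk t).IsFree) => hi.exists_lands ht ht rfl
  choose! rho hrho using fun t (ht : (d.walk t).IsFree) => hi.exists_lands ht ht.rev rfl
  -- The first free side from `a` on whose right ray reaches `b` or beyond. It exists, since
  -- otherwise successive right landings from `a` would increase forever below `b`.
  have climb : ∀ a b, a < b → (d.walk a).IsFree →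
      ∃ p, a ≤ p ∧ p < b ∧ (d.walk p).IsFree ∧ b ≤ rho p ∧
        ∀ j, a ≤ j → j < p → (d.walk j).IsFree → rho j < b := by
    intro a b hab ha
    classical
    have hex : ∃ p, a ≤ p ∧ p < b ∧ (d.walk p).IsFree ∧ b ≤ rho p := by
      by_contra! hno
      have : ∀ n, ∃ p, a + n ≤ p ∧ p < b ∧ (d.walk p).IsFree := by
        intro n
        induction n with
        | zero => exact ⟨a, le_rfl, hab, ha⟩
        | succ n ih =>
          obtain ⟨p, h1, h2, h3⟩ := ih
          have := (hrho p h3).lt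
          exact ⟨rho p, by omega, hno p (by omega) h2 h3, (hrho p h3).isFree⟩
      obtain ⟨p, h1, h2, -⟩ := this b
      omega
    obtain ⟨h1, h2, h3, h4⟩ := Nat.find_spec hex
    refine ⟨Nat.find hex, h1, h2, h3, h4, fun j hj1 hj2 hj3 => ?_⟩
    by_contra! hj4
    exact Nat.find_min hex hj2 ⟨hj1, by omega, hj3, hj4⟩
  -- Let the left ray of `t` land at `k` in the next round. The right ray of `k` lands before `t`,
  -- so the side `p` found by climbing from `k` to `t` lies strictly between them, and its left ray
  -- lands beyond that of `t`. The last condition passes to `p`: the sides `j` concerned come after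
  -- `k`, and minimality of `p` gives `rho j < t ≤ rho p`.
  have descent : ∀ t, (d.walk t).IsFree → t < d.perim → d.perim ≤ lam t →
      (∀ j < t, (d.walk j).IsFree → lam t ≤ j + d.perim → rho j < rho t) → False := by
    intro t
    induction t using Nat.strong_induction_on with
    | _ t ih =>
      intro ht htm hml hP
      have hl := hlam t ht
      obtain ⟨k, hk⟩ := Nat.exists_eq_add_of_le' hml
      rw [hk] at hl hP
      have hkt : k < t := by have := hl.lt_add; omega
      have hkf : (d.walk k).IsFree := by
        have := hl.isFree
        rwa [Flag.walk_add_perim] at this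
      have h1 := hi.lands_right_of_lands_left hX hkf ht hkt hl (hrho k hkf) (hrho t ht)
        (hcon k (by omega) hkf) (hP k hkt hkf le_rfl)
      obtain ⟨p, hkp, hpt, hpf, htp, hmin⟩ := climb k t hkt hkf
      have hkp : k < p := hkp.lt_of_ne (by rintro rfl; omega)
      have h2 := hi.lt_lands_left hX ht hpf hkp hpt hl (hrho t ht) (hrho p hpf) (hlam p hpf)
        (hcon p (by omega) hpf) htp (hP p hpt hpf (by omega))
      refine ih p hpt hpf (by omega) (by omega) fun j hj hjf hjl => ?_
      have := hmin j (by omega) hj hjf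
      omega
  obtain ⟨s, -, hs, hsf, hsr, hmin⟩ := climb 0 d.perim hm hd
  have := hi.lands_right_lt_left hsf (hlam s hsf) (hrho s hsf)
  refine descent s hsf hs (by omega) fun j hj hjf _ => ?_
  have := hmin j (Nat.zero_le _) hj hjf
  omega

end

end IsHypIndex

/-! ### Components of links -/

/-- The ends `x` and `y` of 1-cells bound a common corner of a square. -/
def LinkAdj (X : SquareComplex.{u}) (x y : X.E × Bool) : Prop :=
  ∃ z : Flag X, z.half = x ∧ z.turn.half = y

/-- the component of `x` in the link of its vertex -/
def linkComponent (X : SquareComplex.{u}) (x : X.E × Bool) : Set (X.E × Bool) :=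
  {y | Relation.ReflTransGen X.LinkAdj x y}

theorem LinkAdj.symm {x y : X.E × Bool} (h : X.LinkAdj x y) : X.LinkAdj y x := by
  obtain ⟨z, rfl, rfl⟩ := h
  exact ⟨z.turn, rfl, by rw [Flag.turn_turn]⟩

theorem mem_linkComponent_self (x : X.E × Bool) : x ∈ X.linkComponent x := .refl

theorem mem_linkComponent_symm {x y : X.E × Bool} (h : y ∈ X.linkComponent x) :
    x ∈ X.linkComponent y := by
  induction h with
  | refl => exact .refl
  | tail _ h ih => exact ih.head h.symm

theorem mem_linkComponent_trans {x y z : X.E × Bool} (h : y ∈ X.linkComponent x)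
    (h' : z ∈ X.linkComponent y) : z ∈ X.linkComponent x :=
  Relation.ReflTransGen.trans h h'

theorem turn_half_mem_iff {z : Flag X} {x : X.E × Bool} :
    z.turn.half ∈ X.linkComponent x ↔ z.half ∈ X.linkComponent x :=
  ⟨fun h => h.tail ⟨z.turn, rfl, by rw [Flag.turn_turn]⟩, fun h => h.tail ⟨z, rfl, rfl⟩⟩

theorem ends_of_mem_linkComponent {x y : X.E × Bool} (h : y ∈ X.linkComponent x) :
    X.ends y.1 y.2 = X.ends x.1 x.2 := by
  induction h with
  | refl => rfl
  | tail _ h ih =>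
    obtain ⟨z, rfl, rfl⟩ := h
    rw [← ih]
    exact z.turn_src

theorem eq_of_mem_linkComponent {x y : X.E × Bool} (hx : ∀ z : Flag X, z.edge ≠ x.1)
    (h : y ∈ X.linkComponent x) : y = x := by
  rcases Relation.ReflTransGen.cases_head h with h | ⟨w, ⟨z, hz, -⟩, -⟩
  · exact h.symm
  · exact absurd (congrArg Prod.fst hz) (hx z)

theorem mem_linkComponent_corner {a : Flag X} (ha : a.IsFree) (ha' : a.turn.IsFree)
    {y : X.E × Bool} (h : y ∈ X.linkComponent a.half) : y = a.half ∨ y = a.turn.half := by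
  induction h with
  | refl => exact .inl rfl
  | tail _ h ih =>
    obtain ⟨z, rfl, rfl⟩ := h
    rcases ih with h | h
    · rw [ha.eq h]
      exact .inr rfl
    · rw [ha'.eq h, Flag.turn_turn]
      exact .inl rfl

/-! ### Blocks -/

/-- The flags `z` and `z'` are joined by a sequence of squares that successively share 1-cells. -/
def Flag.SameBlock (z z' : Flag X) : Prop :=
  ∀ P : Flag X → Prop, (∀ d, P d → P d.rev) → (∀ d, P d → P d.turn) → (∀ d, P d → P d.flip) →
    P z → P z'

namespace Flag.SameBlock

theorem trans {a b c : Flag X} (h : a.SameBlock b) (h' : b.SameBlock c) : a.SameBlock c :=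
  fun P h1 h2 h3 h4 => h' P h1 h2 h3 (h P h1 h2 h3 h4)

theorem walk (d : Flag X) (t : ℕ) : d.SameBlock (d.walk t) := by
  intro P h1 h2 h3 h4
  induction t with
  | zero => exact h4
  | succ t ih =>
    rw [walk_succ]
    by_cases h : (d.walk t).IsFree
    · rw [cross_of_isFree h]
      exact h2 _ (h1 _ ih)
    · rw [cross_of_not_isFree h]
      exact h2 _ (h3 _ ih)

theorem iterate_step (d : Flag X) (n : ℕ) : d.SameBlock (step^[n] d) := by
  intro P h1 h2 h3 h4
  induction n with
  | zero => exact h4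
  | succ n ih =>
    rw [Function.iterate_succ_apply']
    by_cases h : (step^[n] d).IsFree
    · rwa [step_of_isFree h]
    · rw [step_of_not_isFree h, ← turn_rev_turn]
      exact h2 _ (h1 _ (h2 _ (h3 _ ih)))

end Flag.SameBlock

/-! ### Branches -/

/-- `χ` is the set of the vertices which `x` separates from its own vertex: those that are joined
to this vertex only by paths which leave it through the component of `x` in the link. -/
structure IsBranch (X : SquareComplex.{u}) (x : X.E × Bool) (χ : X.V → Bool) : Prop where
  base : χ (X.ends x.1 x.2) = false
  change : ∀ e b, χ (X.ends e b) ≠ χ (X.ends e (!b)) ↔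
    Xor ((e, b) ∈ X.linkComponent x) ((e, !b) ∈ X.linkComponent x)

/-- The curve here is a small loop around the part of the vertex that belongs to one link component.
Turning at a corner preserves the component, so `exists_coloring` applies with `Flag.turn`. -/
theorem exists_isBranch [ContractibleSpace X.Realization] (x : X.E × Bool) :
    ∃ χ, X.IsBranch x χ := by
  obtain ⟨χ, hχ⟩ := exists_coloring (X.linkComponent x) Flag.turn (fun _ => rfl) (fun _ => rfl)
    Flag.turn_turn fun _ => turn_half_mem_iff.2
  refine ⟨fun v => xor (χ v) (χ (X.ends x.1 x.2)), by simp, fun e b => ?_⟩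
  rw [← hχ]
  simp

namespace IsBranch

variable {x y : X.E × Bool} {χ ψ : X.V → Bool}

theorem base_of_mem (h : X.IsBranch x χ) {y : X.E × Bool} (hy : y ∈ X.linkComponent x) :
    χ (X.ends y.1 y.2) = false := by
  rw [ends_of_mem_linkComponent hy, h.base]

theorem mem_of_ne (h : X.IsBranch x χ) {e : X.E} {b : Bool}
    (hne : χ (X.ends e b) ≠ χ (X.ends e (!b))) (hb : (e, b) ∉ X.linkComponent x) :
    (e, !b) ∈ X.linkComponent x :=
  ((h.change e b).1 hne).elim (fun h => absurd h.1 hb) fun h => h.1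

theorem change_flag (h : X.IsBranch x χ) (z : Flag X) :
    χ z.src ≠ χ z.rev.src ↔
      Xor (z.half ∈ X.linkComponent x) (z.rev.half ∈ X.linkComponent x) := by
  unfold Flag.src
  rw [Flag.half_rev]
  exact h.change _ _

theorem eq_false_of_forall [PreconnectedSpace X.Realization] {θ : X.V → Bool} {w : X.V}
    (hw : θ w = false) (h : ∀ e b, θ (X.ends e b) = true → θ (X.ends e (!b)) = true) (v : X.V) :
    θ v = false := by
  rw [eq_of_forall_ends_eq θ (fun e => ?_) v w, hw]
  exact Bool.eq_iff_iff.2 ⟨h e false, h e true⟩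

/-- A branch at a vertex of another branch that does not contain the vertex of the latter is
contained in it. -/
theorem subset [PreconnectedSpace X.Realization] (hx : X.IsBranch x χ) (hy : X.IsBranch y ψ)
    (hxy : χ (X.ends y.1 y.2) = true) (hyx : ψ (X.ends x.1 x.2) = false) (v : X.V)
    (hv : ψ v = true) : χ v = true := by
  -- The difference of the two branches is closed under adjacency and misses the vertex of `x`, so
  -- it is empty by connectedness.
  have key := eq_false_of_forall (θ := fun v => ψ v && !χ v) (w := X.ends x.1 x.2)
    (by simp [hyx]) (by
      intro e b hp
      simp only [Bool.and_eq_true, Bool.not_eq_true'] at hp ⊢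
      obtain ⟨p1, p2⟩ := hp
      have q1 : (e, b) ∉ X.linkComponent y := fun h => by
        rw [ends_of_mem_linkComponent h, hxy] at p2
        exact absurd p2 (by decide)
      have q2 : (e, b) ∉ X.linkComponent x := fun h => by
        rw [ends_of_mem_linkComponent h, hyx] at p1
        exact absurd p1 (by decide)
      have q3 : χ (X.ends e (!b)) = false := by
        by_contra h
        exact h (hx.base_of_mem (hx.mem_of_ne (by rw [p2]; exact Ne.symm h) q2))
      refine ⟨?_, q3⟩
      by_contra h
      have h1 := ends_of_mem_linkComponent (hy.mem_of_ne (by rw [p1]; exact Ne.symm h) q1)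
      rw [h1, hxy] at q3
      exact absurd q3 (by decide)) v
  simpa [hv] using key

/-- A 1-cell leaving the intersection would have to end at the common vertex in both link components
at once. So the intersection is closed under adjacency, and it misses that vertex. -/
theorem disjoint [PreconnectedSpace X.Realization] (hx : X.IsBranch x χ) (hy : X.IsBranch y ψ)
    (hxy : X.ends x.1 x.2 = X.ends y.1 y.2) (hne : y ∉ X.linkComponent x) (v : X.V)
    (hv : χ v = true) (hv' : ψ v = true) : False := by
  have key : ∀ {x y χ ψ}, X.IsBranch x χ → X.IsBranch y ψ → X.ends x.1 x.2 = X.ends y.1 y.2 →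
      y ∉ X.linkComponent x → ∀ e b, χ (X.ends e b) = true → ψ (X.ends e b) = true →
      χ (X.ends e (!b)) = true := by
    intro x y χ ψ hx hy hxy hne e b p1 p2
    by_contra h
    have q1 : (e, b) ∉ X.linkComponent x := fun h' => by
      rw [hx.base_of_mem h'] at p1
      exact absurd p1 (by decide)
    have q2 : (e, b) ∉ X.linkComponent y := fun h' => by
      rw [hy.base_of_mem h'] at p2
      exact absurd p2 (by decide)
    have h1 := hx.mem_of_ne (by rw [p1]; exact Ne.symm h) q1
    have h2 := hy.mem_of_ne (e := e) (b := b) (by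
      rw [p2, ends_of_mem_linkComponent h1, hxy, hy.base]
      decide) q2
    exact hne (mem_linkComponent_trans h1 (mem_linkComponent_symm h2))
  have := eq_false_of_forall (θ := fun v => χ v && ψ v) (w := X.ends x.1 x.2)
    (by simp [hx.base]) (by
      intro e b hp
      simp only [Bool.and_eq_true] at hp ⊢
      exact ⟨key hx hy hxy hne e b hp.1 hp.2,
        key hy hx hxy.symm (fun h => hne (mem_linkComponent_symm h)) e b hp.2 hp.1⟩) v
  simp [hv, hv'] at this

/-- A block that contains `x` lies in its branch. -/
theorem inside (h : X.IsBranch x χ) {z z' : Flag X} (hz : z.half ∈ X.linkComponent x)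
    (hzz : z.SameBlock z') :
    (z'.src = X.ends x.1 x.2 → z'.half ∈ X.linkComponent x) ∧
      (z'.src ≠ X.ends x.1 x.2 → χ z'.src = true) := by
  have hs : ∀ d : Flag X, d.half ∈ X.linkComponent x → d.src = X.ends x.1 x.2 :=
    fun d hd => ends_of_mem_linkComponent hd
  refine hzz (fun z' => (z'.src = X.ends x.1 x.2 → z'.half ∈ X.linkComponent x) ∧
      (z'.src ≠ X.ends x.1 x.2 → χ z'.src = true)) ?_ ?_ ?_
    ⟨fun _ => hz, fun h' => absurd (hs z hz) h'⟩
  · rintro d ⟨h1, h2⟩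
    have h3 := h.change_flag d
    have hb := h.base
    by_cases e1 : d.src = X.ends x.1 x.2
    · refine ⟨fun e2 => ?_, fun e2 => ?_⟩
      · by_contra hn
        have h4 := h3.2 (.inl ⟨h1 e1, hn⟩)
        rw [e1, e2] at h4
        exact h4 rfl
      · have h4 := h3.2 (.inl ⟨h1 e1, fun hn => e2 (hs _ hn)⟩)
        rw [e1, hb] at h4
        simpa using h4.symm
    · have hn : d.half ∉ X.linkComponent x := fun hn => e1 (hs _ hn)
      refine ⟨fun e2 => ?_, fun e2 => ?_⟩
      · have h4 := h3.1 (by rw [h2 e1, e2, hb]; decide)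
        exact (h4.resolve_left fun h5 => hn h5.1).1
      · by_contra hc
        have h4 := h3.1 (by rw [h2 e1]; exact Ne.symm hc)
        exact e2 (hs _ (h4.resolve_left fun h5 => hn h5.1).1)
  · rintro d ⟨h1, h2⟩
    rw [Flag.turn_src, turn_half_mem_iff]
    exact ⟨h1, h2⟩
  · rintro d ⟨h1, h2⟩
    rw [Flag.flip_src, Flag.flip_half]
    exact ⟨h1, h2⟩

/-- A block that contains another end of a 1-cell at the vertex of `x` is disjoint from its
branch. -/
theorem outside (h : X.IsBranch x χ) {z z' : Flag X} (hz : z.src = X.ends x.1 x.2)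
    (hz' : z.half ∉ X.linkComponent x) (hzz : z.SameBlock z') : χ z'.src = false := by
  have hs : ∀ d : Flag X, d.half ∈ X.linkComponent x → d.src = X.ends x.1 x.2 :=
    fun d hd => ends_of_mem_linkComponent hd
  refine (hzz (fun z' => z'.half ∉ X.linkComponent x ∧ χ z'.src = false) ?_ ?_ ?_
    ⟨hz', by rw [hz, h.base]⟩).2
  · rintro d ⟨h1, h2⟩
    have h3 := h.change_flag d
    have hb := h.base
    have hs2 := hs d.rev
    by_cases e2 : d.rev.half ∈ X.linkComponent x <;> simp_all [Xor]
  · rintro d ⟨h1, h2⟩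
    rw [Flag.turn_src, turn_half_mem_iff]
    exact ⟨h1, h2⟩
  · rintro d ⟨h1, h2⟩
    rw [Flag.flip_src, Flag.flip_half]
    exact ⟨h1, h2⟩

end IsBranch

/-! ### Recognizing corners and spurs -/

theorem isSpur_of_forall {x : X.E × Bool}
    (h : ∀ y : X.E × Bool, X.ends y.1 y.2 = X.ends x.1 x.2 → y = x) :
    X.IsSpur (X.ends x.1 x.2) := by
  unfold IsSpur degree
  rw [Set.ncard_eq_one]
  exact ⟨x, Set.ext fun y => ⟨h y, by rintro rfl; rfl⟩⟩

namespace IsHypIndex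

variable (hi : X.IsHypIndex idx)
include hi

theorem sameBlock_symm {z z' : Flag X} (h : z.SameBlock z') : z'.SameBlock z := by
  refine h (fun d => d.SameBlock z) ?_ ?_ ?_ fun _ _ _ _ h => h
  · intro d hd P h1 h2 h3 h4
    exact hd P h1 h2 h3 (by simpa using h1 _ h4)
  · intro d hd P h1 h2 h3 h4
    exact hd P h1 h2 h3 (by simpa using h2 _ h4)
  · intro d hd P h1 h2 h3 h4
    exact hd P h1 h2 h3 (by simpa only [hi.flip_flip] using h3 _ h4)

theorem isCorner_of_forall {a : Flag X} (ha : a.IsFree) (ha' : a.turn.IsFree)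
    (h : ∀ y : X.E × Bool, X.ends y.1 y.2 = a.src → y ∈ X.linkComponent a.half) :
    X.IsCorner a.src := by
  have hne : a.half ≠ a.turn.half := fun h =>
    a.turn_ne (hi.eq_of_sq_eq (d := a.turn) (d' := a) rfl h.symm)
  have h1 : ∀ z : Flag X, z.src = a.src → z = a ∨ z = a.turn := fun z hz =>
    (mem_linkComponent_corner ha ha' (h z.half hz)).imp ha.eq ha'.eq
  constructor
  · unfold degree
    rw [Set.ncard_eq_two]
    refine ⟨a.half, a.turn.half, hne, Set.ext fun y => ⟨fun hy =>
      mem_linkComponent_corner ha ha' (h y hy), ?_⟩⟩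
    rintro (rfl | rfl)
    · rfl
    · exact a.turn_src
  · unfold squareDegree
    rw [Set.ncard_eq_one]
    -- Corners of squares correspond to forward flags, and exactly one of `a` and `a.turn` is
    -- forward.
    obtain ⟨c, hc, hc', hcf⟩ : ∃ c : Flag X, c.src = a.src ∧ c.fwd = true ∧
        ∀ z : Flag X, z.src = a.src → z.fwd = true → z = c := by
      have hf : a.turn.fwd = !a.fwd := rfl
      rcases hb : a.fwd with _ | _
      · rw [hb] at hf
        refine ⟨a.turn, a.turn_src, hf, fun z hz hz' => (h1 z hz).resolve_left ?_⟩
        rintro rfl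
        simp [hb] at hz'
      · rw [hb] at hf
        refine ⟨a, rfl, hb, fun z hz hz' => (h1 z hz).resolve_right ?_⟩
        rintro rfl
        simp [hf] at hz'
    refine ⟨(c.sq, c.pos), Set.ext fun y => ⟨fun hy => ?_, ?_⟩⟩
    · have h2 : (⟨y.1, y.2, true⟩ : Flag X).src = a.src := by
        simpa [Flag.src, Flag.half] using hy
      rw [← hcf _ h2 rfl]
      rfl
    · rintro rfl
      rw [← hc]
      simp [Flag.src, Flag.half, hc']

section
variable [Finite X.E] [Finite X.Q] [ContractibleSpace X.Realization]
  (hX : ∀ h h', h ≠ h' → (X.crossings h h').encard ≤ 2)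
include hX

/-- In the block of a free side `d` there is a component of a link that is a single corner of a
square, other than the component of `d`. -/
theorem exists_corner_component {d : Flag X} (hd : d.IsFree) :
    ∃ a : Flag X, d.SameBlock a ∧ a.IsFree ∧ a.turn.IsFree ∧
      d.half ∉ X.linkComponent a.half := by
  obtain ⟨t, ht, h1, h2⟩ := hi.exists_corner_gap hX hd
  have h3 : (d.walk (t + 1)).turn = (d.walk t).rev := by
    rw [Flag.walk_succ_of_isFree h1, Flag.turn_turn]
  have h4 : (d.walk (t + 1)).turn.IsFree := by
    rw [h3]
    exact h1.rev
  refine ⟨d.walk (t + 1), .walk d _, h2, h4, fun h => ?_⟩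
  rcases mem_linkComponent_corner h2 h4 h with h | h
  · exact hi.walk_ne (s := 0) (t := t + 1) (by omega) (by omega) (h2.eq h).symm
  · have h5 := h4.eq h
    rw [h3] at h5
    exact hi.walk_ne_rev hd ((congrArg Flag.rev h5).trans (Flag.rev_rev _)).symm

/-- Either the first block or 1-cell of the branch supplies a corner or spur away from the base
vertex, or the vertex found there carries a further link component, whose branch is smaller because
it omits that vertex. -/
theorem exists_corner_or_spur_in_branch [Finite X.V] (n : ℕ) : ∀ {x : X.E × Bool} {χ : X.V → Bool},
    X.IsBranch x χ → {v | χ v = true}.ncard = n →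
    ∃ v, χ v = true ∧ (X.IsCorner v ∨ X.IsSpur v) := by
  induction n using Nat.strong_induction_on with
  | _ n ih =>
  intro x χ hx hn
  have recurse : ∀ y : X.E × Bool, χ (X.ends y.1 y.2) = true →
      (∀ ψ, X.IsBranch y ψ → ψ (X.ends x.1 x.2) = false) →
      ∃ v, χ v = true ∧ (X.IsCorner v ∨ X.IsSpur v) := by
    intro y hxy hyx
    obtain ⟨ψ, hy⟩ := exists_isBranch y
    have hsub := hx.subset hy hxy (hyx ψ hy)
    have hlt : {v | ψ v = true}.ncard < {v | χ v = true}.ncard := by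
      refine Set.ncard_lt_ncard ⟨hsub, fun hle => ?_⟩ (Set.toFinite _)
      have : ψ (X.ends y.1 y.2) = true := hle hxy
      rw [hy.base] at this
      exact absurd this (by decide)
    obtain ⟨v, hv, hv'⟩ := ih _ (hn ▸ hlt) hy rfl
    exact ⟨v, hsub v hv, hv'⟩
  by_cases hsq : ∃ z : Flag X, z.edge = x.1
  · obtain ⟨z, hz⟩ : ∃ z : Flag X, z.half = x := by
      obtain ⟨z, hz⟩ := hsq
      by_cases hb : z.half.2 = x.2
      · exact ⟨z, Prod.ext hz hb⟩
      · refine ⟨z.rev, ?_⟩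
        rw [Flag.half_rev]
        refine Prod.ext hz ?_
        revert hb
        cases z.half.2 <;> cases x.2 <;> simp
    have hzx : z.half ∈ X.linkComponent x := hz ▸ mem_linkComponent_self _
    have hzw : z.src = X.ends x.1 x.2 := ends_of_mem_linkComponent hzx
    -- The walk starts at the base vertex if the block has a free side there. The corner found is
    -- then not at the base vertex, as its link component would be that of `d`; without such a free
    -- side this is automatic.
    obtain ⟨d, hd, hzd, hd'⟩ : ∃ d : Flag X, d.IsFree ∧ z.SameBlock d ∧
        (d.src = X.ends x.1 x.2 ∨ ∀ d' : Flag X, d'.IsFree → z.SameBlock d' →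
          d'.src ≠ X.ends x.1 x.2) := by
      by_cases hw : ∃ d : Flag X, d.IsFree ∧ z.SameBlock d ∧ d.src = X.ends x.1 x.2
      · obtain ⟨d, h1, h2, h3⟩ := hw
        exact ⟨d, h1, h2, .inl h3⟩
      · push Not at hw
        obtain ⟨n, hn⟩ := hi.exists_rayLength z
        exact ⟨_, hn.1, .iterate_step z n, .inr hw⟩
    obtain ⟨a, hda, ha, ha', hne⟩ := hi.exists_corner_component hX hd
    have hza := hzd.trans hda
    have haw : a.src ≠ X.ends x.1 x.2 := by
      rcases hd' with hdw | hw
      · intro haw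
        exact hne (mem_linkComponent_trans
          (mem_linkComponent_symm ((hx.inside hzx hza).1 haw)) ((hx.inside hzx hzd).1 hdw))
      · exact hw a ha hza
    have haχ := (hx.inside hzx hza).2 haw
    by_cases hall : ∀ y : X.E × Bool, X.ends y.1 y.2 = a.src → y ∈ X.linkComponent a.half
    · exact ⟨a.src, haχ, .inl (hi.isCorner_of_forall ha ha' hall)⟩
    · push Not at hall
      obtain ⟨y, hy, hya⟩ := hall
      refine recurse y (by rw [hy, haχ]) fun ψ hψ => ?_
      rw [← hzw]
      exact hψ.outside hy.symm (fun h => hya (mem_linkComponent_symm h)) (hi.sameBlock_symm hza)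
  · push Not at hsq
    have hsq' : ∀ b, ∀ y ∈ X.linkComponent (x.1, b), y = (x.1, b) :=
      fun b y hy => eq_of_mem_linkComponent hsq hy
    have hne : (x.1, !x.2) ∉ X.linkComponent x := fun h => by
      have := congrArg Prod.snd (hsq' x.2 _ h)
      simp at this
    have h1 := (hx.change x.1 x.2).2 (.inl ⟨mem_linkComponent_self x, hne⟩)
    rw [hx.base] at h1
    have h2 : χ (X.ends x.1 (!x.2)) = true := by simpa using h1.symm
    by_cases hall : ∀ y : X.E × Bool, X.ends y.1 y.2 = X.ends x.1 (!x.2) → y = (x.1, !x.2)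
    · exact ⟨_, h2, .inr (isSpur_of_forall (x := (x.1, !x.2)) hall)⟩
    · push Not at hall
      obtain ⟨y, hy, hya⟩ := hall
      refine recurse y (by rw [hy, h2]) fun ψ hψ => ?_
      have h3 : (x.1, !x.2) ∉ X.linkComponent y := fun h =>
        hya (hsq' _ _ (mem_linkComponent_symm h))
      have h4 := hψ.base
      rw [hy] at h4
      by_contra h5
      have h6 := hψ.mem_of_ne (e := x.1) (b := !x.2) (by rw [h4, Bool.not_not]; exact Ne.symm h5) h3
      rw [Bool.not_not] at h6
      exact h5 (hψ.base_of_mem h6)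

theorem exists_two_corners_or_spurs [Finite X.V] (e : X.E) :
    ∃ v w, v ≠ w ∧ (X.IsCorner v ∨ X.IsSpur v) ∧ (X.IsCorner w ∨ X.IsSpur w) := by
  by_cases hcut : ∃ x y : X.E × Bool, X.ends x.1 x.2 = X.ends y.1 y.2 ∧ y ∉ X.linkComponent x
  · obtain ⟨x, y, hxy, hne⟩ := hcut
    obtain ⟨χ, hx⟩ := exists_isBranch x
    obtain ⟨ψ, hy⟩ := exists_isBranch y
    obtain ⟨v, hv, hv'⟩ := hi.exists_corner_or_spur_in_branch hX _ hx rfl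
    obtain ⟨w, hw, hw'⟩ := hi.exists_corner_or_spur_in_branch hX _ hy rfl
    refine ⟨v, w, ?_, hv', hw'⟩
    rintro rfl
    exact hx.disjoint hy hxy hne v hv hw
  · push Not at hcut
    by_cases hsq : ∃ a, ∀ z : Flag X, z.edge ≠ a
    · obtain ⟨a, ha⟩ := hsq
      have hspur : ∀ b, X.IsSpur (X.ends a b) := fun b =>
        isSpur_of_forall (x := (a, b)) fun y hy =>
          eq_of_mem_linkComponent ha (hcut (a, b) y hy.symm)
      refine ⟨_, _, fun h => ?_, .inr (hspur false), .inr (hspur true)⟩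
      have := congrArg Prod.snd
        (eq_of_mem_linkComponent (x := (a, false)) ha (hcut (a, false) (a, true) h))
      simp at this
    · push Not at hsq
      obtain ⟨z, -⟩ := hsq e
      obtain ⟨n, hn⟩ := hi.exists_rayLength z
      -- The second search starts at the first corner and so finds a different link component; links
      -- being connected, its vertex is different too.
      obtain ⟨a, -, h1, h2, -⟩ := hi.exists_corner_component hX hn.1
      obtain ⟨b, -, k1, k2, hne⟩ := hi.exists_corner_component hX h1
      refine ⟨a.src, b.src, fun h => hne (hcut _ _ h.symm),
        .inl (hi.isCorner_of_forall h1 h2 fun y hy => hcut _ _ hy.symm),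
        .inl (hi.isCorner_of_forall k1 k2 fun y hy => hcut _ _ hy.symm)⟩

end

end IsHypIndex

end SquareComplex

theorem mainTheorem3 (X : SquareComplex.{u}) (hfin : X.IsFinite) (hplanar : X.IsPlanar)
    (hdisk : X.HomotopyEquivDisk) (hstar : X.ConditionStar) (hcells : 2 ≤ Nat.card X.E) :
    ∃ v w : X.V, v ≠ w ∧ (X.IsCorner v ∨ X.IsSpur v) ∧ (X.IsCorner w ∨ X.IsSpur w) := by
  obtain ⟨_, _, _⟩ := hfin
  have := hdisk.contractibleSpace
  obtain ⟨idx, hi⟩ := SquareComplex.exists_hypIndex hstar.1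
  have : Nonempty X.E := (Nat.card_pos_iff.1 (by omega)).1
  exact hi.exists_two_corners_or_spurs hstar.2 (Classical.arbitrary X.E)
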